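/- Consider the $n\times n\times n$ Rubik's cube ($n\ge 1$). A cubie is a unit cube with at least one visible side, and a legal move rotates one slice (the unit cubes with a common value of one coordinate) by $90^\circ$ in either direction. The cluster of a cubie is the set of all positions that it can reach by sequences of legal moves. A configuration of a cluster $C$ is a colouring of the stickers of $C$ that occurs on $C$ when some sequence $v$ of legal moves is applied to the solved cube; it has even parity if $v$ can be chosen so that it induces an even permutation of the cubies of $C$ (cubies with the same colours may thus be labelled in any way that is produced by legal moves). The configuration is solved if each face shows, on $C$, the colour that it has in the solved cube. There is an absolute constant $K$ (independent of $n$) such that the following holds for every $n$ and every cubie cluster $C$. (i) For every configuration of $C$ with even parity, and every such $v$ that produces it with an even permutation of the cubies of $C$, there is a sequence of at most $K$ legal moves which solves $C$, which in fact returns each individual sticker that $v$ has moved within $C$ to its home, and which leaves every other cluster unaffected: every sticker outside $C$ ends where it started. (ii) If $C$ is not the cluster of the six middle cubies of the faces (which exists only for odd $n\ge 3$), then every even permutation of the cubies of $C$ is realized by a sequence of at most $K$ legal moves that leaves every sticker outside $C$ where it was. -/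

import Mathlib

namespace RubiksCube

/-- A position `(i, j, k)` in the `n × n × n` cube, with coordinates in `{0, …, n - 1}`.
A cubie is named by the position that it occupies in the solved cube. -/
abbrev Pos (n : ℕ) := Fin 3 → Fin n

/-- The six faces of the cube: `(d, true)` is the face `x_d = n - 1` and `(d, false)` is the
face `x_d = 0`. The six colours are named by the faces that carry them in the solved cube. -/
abbrev Face := Fin 3 × Bool

/-- The unit cube at position `p` touches the face `F`. -/
def OnFace {n : ℕ} (p : Pos n) (F : Face) : Prop :=
  if F.2 then (p F.1 : ℕ) + 1 = n else (p F.1 : ℕ) = 0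

/-- A position is visible if the unit cube there has at least one side on a face of the cube. -/
def Visible {n : ℕ} (p : Pos n) : Prop := ∃ F : Face, OnFace p F

/-- A facelet: a visible side of a unit cube, given by its position and the face it lies on. -/
abbrev Facelet (n : ℕ) := {x : Pos n × Face // OnFace x.1 x.2}

/-- The position of the unit cube to which a facelet belongs. -/
abbrev Facelet.pos {n : ℕ} (f : Facelet n) : Pos n := f.1.1

/-- The face on which a facelet lies. -/
abbrev Facelet.face {n : ℕ} (f : Facelet n) : Face := f.1.2

/-- Rotation of positions by 90 degrees about the axis `a`:
`(x_{a+1}, x_{a+2})` becomes `(n - 1 - x_{a+2}, x_{a+1})`, axes being counted modulo 3. -/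
def rotPos {n : ℕ} (a : Fin 3) : Equiv.Perm (Pos n) where
  toFun p := fun b => if b = a then p a else if b = a + 1 then (p (a + 2)).rev else p (a + 1)
  invFun p := fun b => if b = a then p a else if b = a + 1 then p (a + 2) else (p (a + 1)).rev
  left_inv p := by
    funext b
    fin_cases a <;> fin_cases b <;> simp
  right_inv p := by
    funext b
    fin_cases a <;> fin_cases b <;> simp

/-- The same rotation, acting on the six faces. -/
def rotFace (a : Fin 3) : Equiv.Perm Face where
  toFun F := if F.1 = a then F else if F.1 = a + 1 then (a + 2, F.2) else (a + 1, !F.2)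
  invFun F := if F.1 = a then F else if F.1 = a + 1 then (a + 2, !F.2) else (a + 1, F.2)
  left_inv := by revert a; decide
  right_inv := by revert a; decide

theorem onFace_rot {n : ℕ} (a : Fin 3) (p : Pos n) (F : Face) :
    OnFace (rotPos a p) (rotFace a F) ↔ OnFace p F := by
  obtain ⟨d, t⟩ := F
  have h0 := (p 0).isLt
  have h1 := (p 1).isLt
  have h2 := (p 2).isLt
  fin_cases a <;> fin_cases d <;> cases t <;>
    simp [OnFace, rotPos, rotFace, Fin.val_rev] <;> omega

theorem onFace_rot_symm {n : ℕ} (a : Fin 3) (p : Pos n) (F : Face) (h : OnFace p F) :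
    OnFace ((rotPos a).symm p) ((rotFace a).symm F) := by
  rw [← onFace_rot a]
  simpa using h

/-- Rotation of facelets by 90 degrees about the axis `a`. -/
def rotFacelet {n : ℕ} (a : Fin 3) : Equiv.Perm (Facelet n) where
  toFun f := ⟨(rotPos a f.pos, rotFace a f.face), (onFace_rot a _ _).2 f.2⟩
  invFun f := ⟨((rotPos a).symm f.pos, (rotFace a).symm f.face), onFace_rot_symm a _ _ f.2⟩
  left_inv _ := Subtype.ext (Prod.ext ((rotPos a).symm_apply_apply _)
    ((rotFace a).symm_apply_apply _))
  right_inv _ := Subtype.ext (Prod.ext ((rotPos a).apply_symm_apply _)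
    ((rotFace a).apply_symm_apply _))

theorem rotPos_axis {n : ℕ} (a : Fin 3) (p : Pos n) : rotPos a p a = p a := by
  simp [rotPos]

theorem rotPos_symm_axis {n : ℕ} (a : Fin 3) (p : Pos n) : (rotPos a).symm p a = p a := by
  simp [rotPos]

/-- Turning the slice `x_a = s` by 90 degrees about the axis `a`: the effect on positions. -/
def turnPos {n : ℕ} (a : Fin 3) (s : Fin n) : Equiv.Perm (Pos n) where
  toFun p := if p a = s then rotPos a p else p
  invFun p := if p a = s then (rotPos a).symm p else p
  left_inv p := by
    by_cases h : p a = s <;> simp [h, rotPos_axis]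
  right_inv p := by
    by_cases h : p a = s <;> simp [h, rotPos_symm_axis]

/-- Turning the slice `x_a = s` by 90 degrees about the axis `a`: the effect on facelets. -/
def turnFacelet {n : ℕ} (a : Fin 3) (s : Fin n) : Equiv.Perm (Facelet n) where
  toFun f := if f.pos a = s then rotFacelet a f else f
  invFun f := if f.pos a = s then (rotFacelet a).symm f else f
  left_inv f := by
    by_cases h : f.pos a = s
    · have h' : (rotFacelet a f).pos a = s := by
        rw [← h]; exact rotPos_axis a f.pos
      simp only [h, h', if_true, Equiv.symm_apply_apply]
    · simp only [h, if_false]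
  right_inv f := by
    by_cases h : f.pos a = s
    · have h' : ((rotFacelet a).symm f).pos a = s := by
        rw [← h]; exact rotPos_symm_axis a f.pos
      simp only [h, h', if_true, Equiv.apply_symm_apply]
    · simp only [h, if_false]

/-- A legal move: rotate the slice `x_axis = layer` by 90 degrees, in one of the two directions. -/
structure Move (n : ℕ) where
  axis : Fin 3
  layer : Fin n
  positive : Bool

/-- The effect of a move on positions: what is at `p` before the move is at `m.onPos p` after. -/
def Move.onPos {n : ℕ} (m : Move n) : Equiv.Perm (Pos n) :=
  if m.positive then turnPos m.axis m.layer else (turnPos m.axis m.layer)⁻¹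

/-- The effect of a move on facelets: the sticker at `f` before the move is at
`m.onFacelet f` after it. -/
def Move.onFacelet {n : ℕ} (m : Move n) : Equiv.Perm (Facelet n) :=
  if m.positive then turnFacelet m.axis m.layer else (turnFacelet m.axis m.layer)⁻¹

/-- The effect on positions of a sequence of moves, performed from left to right. -/
def runPos {n : ℕ} : List (Move n) → Equiv.Perm (Pos n)
  | [] => 1
  | m :: w => runPos w * m.onPos

/-- The effect on facelets of a sequence of moves, performed from left to right. -/
def run {n : ℕ} : List (Move n) → Equiv.Perm (Facelet n)
  | [] => 1
  | m :: w => run w * m.onFacelet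

/-- A cubie cluster: all positions that one visible cubie can reach by sequences of legal moves. -/
def IsCluster {n : ℕ} (C : Finset (Pos n)) : Prop :=
  ∃ p : Pos n, Visible p ∧ ∀ q : Pos n, q ∈ C ↔ ∃ w : List (Move n), runPos w p = q

/-- A colouring of the visible facelets. -/
abbrev Config (n : ℕ) := Facelet n → Face

/-- The solved cube: each face is of one colour. -/
def solved (n : ℕ) : Config n := fun f => f.face

/-- The colouring that results from the colouring `c` by performing the moves `w`. -/
def applyMoves {n : ℕ} (w : List (Move n)) (c : Config n) : Config n := fun f => c ((run w)⁻¹ f)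

/-- The colourings `c` and `c'` agree on the cluster `C`. -/
def AgreeOn {n : ℕ} (C : Finset (Pos n)) (c c' : Config n) : Prop :=
  ∀ f : Facelet n, f.pos ∈ C → c f = c' f

/-- The sequence `w` permutes the cubies of the cluster `C` according to `π`. -/
def Realizes {n : ℕ} {C : Finset (Pos n)} (w : List (Move n)) (π : Equiv.Perm C) : Prop :=
  ∀ p : C, runPos w p = (π p : Pos n)

/-- The sequence `w` permutes the cubies of the cluster `C` evenly. -/
def EvenOn {n : ℕ} (C : Finset (Pos n)) (w : List (Move n)) : Prop :=
  ∃ π : Equiv.Perm C, Realizes w π ∧ Equiv.Perm.sign π = 1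

/-- The sequence `w` brings every sticker outside `C` back to where it was. -/
def AffectsOnly {n : ℕ} (C : Finset (Pos n)) (w : List (Move n)) : Prop :=
  ∀ f : Facelet n, f.pos ∉ C → run w f = f

/-- `p` is the middle of one of the six faces of a cube of odd size at least 3. -/
def IsFaceMidpoint {n : ℕ} (p : Pos n) : Prop :=
  ∃ F : Face, OnFace p F ∧ ∀ b : Fin 3, 2 * (p b : ℕ) + 1 = n ↔ b ≠ F.1

end RubiksCube

/-! Clusters have bounded size: turns only permute and reflect coordinates, so a cluster has at most
216 cubies and 1296 facelets, whatever `n` is. Call a sequence local if it affects only `C`;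
`clusterGroup C` is generated by the conjugates of local sequences of at most 8 moves. Pigeonhole in
the permutations of the facelets of `C` bounds the length of its elements: a conjugator matters only
through its action on `C`, so `1296!` moves suffice for it, and a product of conjugates shrinks to
at most `1296!` factors. It remains to see that a sequence that is even on `C` acts there like an
element of `clusterGroup C`, i.e. lies in `localGroup` (`run_mem_localGroup_of_evenOn`).

Local sequences come from commutators of permutations whose supports meet only in `C`. Unless `C`
consists of face midpoints, a slice and a conjugated slice overlap in a single cubie, and their
commutator is a 3-cycle of cubies. The moves act transitively on `C`, and primitively because each
of them fixes a point of this 3-cycle, so by Jordan's theorem they produce every even permutation.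
Conjugating by these gives all 3-cycles locally, hence the alternating group
(`alternatingGroup_le_localPerms`). This proves (ii), and also (i) for centers and wings, where an
invariant shows that the position of a cubie determines its orientation.

Corners and middle edges can be twisted in place, and for face midpoints the 3-cycle is missing.
These clusters behave as in a cube of size 2 or 3. There a finite check shows that a fixed reference
turn followed by any active turn is a product of conjugates of one commutator. Modulo the local
group all active turns are thus one class of order at most 2, and each is odd, being a 4-cycle of
cubies; so parity alone decides membership (`run_mem_localGroup_of_moves`). -/

open Equiv Equiv.Perm

/-! ### Short products, commutators and 3-cycles in finite groups -/

/-- In a finite monoid, every product of values of `f` is a product of boundedly many of them. -/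
theorem exists_list_prod_eq_of_length_le {α H : Type*} [Monoid H] [Fintype H] (f : α → H)
    (l : List α) :
    ∃ l' : List α, l'.length ≤ Fintype.card H ∧ (∀ x ∈ l', x ∈ l) ∧
      (l'.map f).prod = (l.map f).prod := by
  induction hk : l.length using Nat.strong_induction_on generalizing l with
  | _ k ih =>
    subst hk
    by_cases hl : l.length ≤ Fintype.card H
    · exact ⟨l, hl, fun _ h => h, rfl⟩
    have hcard : Fintype.card H < Fintype.card (Fin l.length) := by
      rw [Fintype.card_fin]; omega
    -- Two prefixes have equal products, so the segment between them can be cut out.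
    obtain ⟨i, j, hij, he⟩ := Fintype.exists_ne_map_eq_of_card_lt
      (fun i : Fin l.length => ((l.take i).map f).prod) hcard
    wlog h : i < j generalizing i j
    · exact this j i hij.symm he.symm (lt_of_le_of_ne (not_lt.1 h) hij.symm)
    have hij' : (i : ℕ) < j := h
    have hlen : (l.take i ++ l.drop j).length < l.length := by
      simp only [List.length_append, List.length_take, List.length_drop]
      omega
    obtain ⟨l', h1, h2, h3⟩ := ih _ hlen (l.take i ++ l.drop j) rfl
    refine ⟨l', h1, fun x hx => ?_, ?_⟩
    · rcases List.mem_append.1 (h2 x hx) with h | h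
      · exact List.mem_of_mem_take h
      · exact List.mem_of_mem_drop h
    · rw [h3, List.map_append, List.prod_append]
      rw [he, ← List.prod_append, ← List.map_append, List.take_append_drop]

namespace Equiv.Perm

variable {α : Type*}

theorem inv_apply_eq_self_iff (A : Perm α) (x : α) : A⁻¹ x = x ↔ A x = x := by
  rw [Perm.inv_eq_iff_eq, eq_comm]

theorem apply_inv_apply_eq_iff (A : Perm α) (x : α) : A (A⁻¹ x) = A⁻¹ x ↔ A x = x := by
  rw [Perm.eq_inv_iff_eq]
  simp

/-- A commutator moves only what is moved by both factors, and the images of these points. -/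
theorem commutator_apply_eq_self {A B : Perm α} {P : α → Prop}
    (hP : ∀ x, A x ≠ x → B x ≠ x → P x)
    {x : α} (h0 : ¬ P x) (hA : ¬ P (A⁻¹ x)) (hB : ¬ P (B⁻¹ x)) :
    (A * B * A⁻¹ * B⁻¹) x = x := by
  simp only [mul_apply]
  by_cases hb : B x = x
  · rw [(inv_apply_eq_self_iff B x).2 hb]
    by_cases ha : A x = x
    · rw [(inv_apply_eq_self_iff A x).2 ha, hb, ha]
    · have hb' : B (A⁻¹ x) = A⁻¹ x := by
        by_contra h
        exact hA (hP _ (fun h' => ha ((apply_inv_apply_eq_iff A x).1 h')) h)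
      rw [hb', ← mul_apply, mul_inv_cancel, one_apply]
  · have ha : A x = x := by
      by_contra h
      exact h0 (hP _ h hb)
    have ha' : A (B⁻¹ x) = B⁻¹ x := by
      by_contra h
      exact hB (hP _ h (fun h' => hb ((apply_inv_apply_eq_iff B x).1 h')))
    rw [(inv_apply_eq_self_iff A _).2 ha', ← mul_apply B, mul_inv_cancel, one_apply, ha]

section

variable [DecidableEq α]

/-- If two permutations both move only one point `q`, their commutator is a 3-cycle. -/
theorem commutator_eq_swap_mul_swap {A B : Perm α} {q : α}
    (hq : ∀ x, A x ≠ x → B x ≠ x → x = q) (hA : A q ≠ q) (hB : B q ≠ q) :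
    A q ≠ B q ∧ A * B * A⁻¹ * B⁻¹ = swap q (B q) * swap q (A q) := by
  have hBA : B (A q) = A q := by
    by_contra h
    exact hA (hq _ (fun h' => hA (A.injective h')) h)
  have hAB : A (B q) = B q := by
    by_contra h
    exact hB (hq _ h (fun h' => hB (B.injective h')))
  have hne : A q ≠ B q := by
    intro h
    rw [← h] at hAB
    exact hA (A.injective hAB)
  have hB'q : A (B⁻¹ q) = B⁻¹ q := by
    by_contra h
    have h1 := hq _ h (fun h' => hB ((apply_inv_apply_eq_iff B q).1 h'))
    exact hB ((inv_apply_eq_self_iff B q).1 h1)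
  have hA'q : B (A⁻¹ q) = A⁻¹ q := by
    by_contra h
    have h1 := hq _ (fun h' => hA ((apply_inv_apply_eq_iff A q).1 h')) h
    exact hA ((inv_apply_eq_self_iff A q).1 h1)
  have hA1 : A⁻¹ (A q) = q := by simp
  have hB1 : B⁻¹ (B q) = q := by simp
  have hA2 : A (A⁻¹ q) = q := by simp
  have hB2 : B (B⁻¹ q) = q := by simp
  refine ⟨hne, ?_⟩
  ext x
  simp only [mul_apply]
  by_cases h1 : x = q
  · subst h1
    rw [(inv_apply_eq_self_iff A _).2 hB'q, hB2, swap_apply_left, swap_apply_of_ne_of_ne hA hne]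
  by_cases h2 : x = A q
  · rw [h2, (inv_apply_eq_self_iff B _).2 hBA, hA1, hAB, swap_apply_right, swap_apply_left]
  by_cases h3 : x = B q
  · rw [h3, hB1, hA'q, hA2, swap_apply_of_ne_of_ne hB hne.symm, swap_apply_right]
  rw [swap_apply_of_ne_of_ne h1 h2, swap_apply_of_ne_of_ne h1 h3]
  refine commutator_apply_eq_self (P := fun y => y = q) hq h1 ?_ ?_
  · rwa [Perm.inv_eq_iff_eq]
  · rwa [Perm.inv_eq_iff_eq]

variable [Fintype α]

/-- A permutation whose only moved points are the four points of one orbit of length 4 is odd. -/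
theorem sign_eq_neg_one_of_four_cycle {f : Perm α} {x : α} (h2 : f (f x) ≠ x)
    (h4 : f (f (f (f x))) = x)
    (h : ∀ y, f y ≠ y → y = x ∨ y = f x ∨ y = f (f x) ∨ y = f (f (f x))) : sign f = -1 := by
  have h1 : f x ≠ x := fun e => h2 (by rw [e, e])
  have h3 : f (f (f x)) ≠ x := fun e => h1 (by rw [e] at h4; exact h4)
  have h12 : f (f x) ≠ f x := fun e => h1 (f.injective e)
  have h13 : f (f (f x)) ≠ f x := fun e => h2 (f.injective e)
  have h23 : f (f (f x)) ≠ f (f x) := fun e => h12 (f.injective e)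
  have e : f = swap x (f (f (f x))) * swap x (f (f x)) * swap x (f x) := by
    ext y
    simp only [mul_apply]
    by_cases hy : f y = y
    · have hy0 : y ≠ x := fun e => h1 (e ▸ hy)
      have hy1 : y ≠ f x := fun e => h12 (e ▸ hy)
      have hy2 : y ≠ f (f x) := fun e => h23 (e ▸ hy)
      have hy3 : y ≠ f (f (f x)) := fun e => h3 (by rw [e, h4] at hy; exact hy.symm)
      rw [swap_apply_of_ne_of_ne hy0 hy1, swap_apply_of_ne_of_ne hy0 hy2,
        swap_apply_of_ne_of_ne hy0 hy3, hy]
    · rcases h y hy with rfl | rfl | rfl | rfl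
      · rw [swap_apply_left, swap_apply_of_ne_of_ne h1 h12.symm,
          swap_apply_of_ne_of_ne h1 h13.symm]
      · rw [swap_apply_right, swap_apply_left, swap_apply_of_ne_of_ne h2 h23.symm]
      · rw [swap_apply_of_ne_of_ne h2 h12, swap_apply_right, swap_apply_left]
      · rw [h4, swap_apply_of_ne_of_ne h3 h13, swap_apply_of_ne_of_ne h3 h23, swap_apply_right]
  rw [e, sign_mul, sign_mul, sign_swap h1.symm, sign_swap h2.symm, sign_swap h3.symm]
  decide

/-- A subgroup that contains a 3-cycle and is normalized by the even permutations contains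
all even permutations. -/
theorem alternatingGroup_le_of_conj_mem {T : Subgroup (Perm α)} {t : Perm α}
    (ht : t.IsThreeCycle) (htT : t ∈ T)
    (h : ∀ g ∈ alternatingGroup α, ∀ x ∈ T, g * x * g⁻¹ ∈ T) : alternatingGroup α ≤ T := by
  rw [← closure_three_cycles_eq_alternating, Subgroup.closure_le]
  intro s (hs : s.IsThreeCycle)
  obtain ⟨g, hg⟩ := isConj_iff.1 (isConj_iff_cycleType_eq.2 (ht.cycleType.trans hs.cycleType.symm))
  rcases Int.units_eq_one_or (sign g) with h1 | h1
  · rw [← hg]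
    exact h g h1 t htT
  -- An odd conjugator is corrected by a transposition inside the support of `t`, which inverts `t`:
  -- the even permutation `g * swap a (t a)` takes `t` to `s⁻¹`.
  · obtain ⟨a, ha⟩ : t.support.Nonempty := by
      rw [← Finset.card_pos, ht.card_support]; norm_num
    have hne : a ≠ t a := (mem_support.1 ha).symm
    have key : swap a (t a) * t * (swap a (t a))⁻¹ = t⁻¹ := by
      have e1 := ht.eq_swap_mul_swap_iff_mem_support.2 ha
      have aux (u v : Perm α) (hu : u * u = 1) (hv : v⁻¹ = v) :
          u * (u * v) * u⁻¹ = (u * v)⁻¹ := by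
        rw [← mul_assoc, hu, one_mul, mul_inv_rev, hv]
      exact (congrArg (fun z => swap a (t a) * z * (swap a (t a))⁻¹) e1).trans
        ((aux _ _ (swap_mul_self _ _) (swap_inv _ _)).trans (congrArg (·⁻¹) e1.symm))
    have := T.inv_mem (h (g * swap a (t a)) (by
      rw [mem_alternatingGroup, sign_mul, h1, sign_swap hne]; decide) t htT)
    have e2 : (g * swap a (t a) * t * (g * swap a (t a))⁻¹)⁻¹ = s := by
      rw [← hg]
      calc _ = g * (swap a (t a) * t * (swap a (t a))⁻¹)⁻¹ * g⁻¹ := by group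
        _ = _ := by rw [key, inv_inv]
    rwa [e2] at this

open scoped Pointwise in
/-- A transitive group with a 3-cycle is primitive if it is generated by permutations each of
which fixes a point that the 3-cycle moves. -/
theorem isPreprimitive_closure_of_isThreeCycle {S : Set (Perm α)} {t : Perm α}
    (ht : t.IsThreeCycle) (htS : t ∈ Subgroup.closure S)
    [MulAction.IsPretransitive (Subgroup.closure S) α]
    (h : ∀ s ∈ S, ∃ x ∈ t.support, s x = x) :
    MulAction.IsPreprimitive (Subgroup.closure S) α := by
  obtain ⟨a, ha⟩ : t.support.Nonempty := by
    rw [← Finset.card_pos, ht.card_support]; norm_num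
  have hsupp := ht.support_eq_iff_mem_support.2 ha
  have h3 : t (t (t a)) = a := by
    have : (t ^ 3) a = a := by simp [← ht.orderOf]
    simpa [pow_succ] using this
  refine MulAction.IsPreprimitive.of_isTrivialBlock_base a fun {B} haB hB => ?_
  by_cases hsub : B.Subsingleton
  · exact Or.inl hsub
  right
  rw [MulAction.isBlock_iff_smul_eq_of_mem] at hB
  obtain ⟨y, hyB, hya⟩ : ∃ y ∈ B, y ≠ a := by
    by_contra! hc
    exact hsub fun x hx y hy => (hc x hx).trans (hc y hy).symm
  -- The block contains `a` and a second point `y`. If `t` fixes `y`, then `t • B` meets `B` in `y`;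
  -- otherwise `y` is `t a` or `t (t a)`, and again the two meet.
  have htB : (⟨t, htS⟩ : Subgroup.closure S) • B = B := by
    by_cases hy : y ∈ t.support
    · rw [hsupp] at hy
      simp only [Finset.mem_insert, Finset.mem_singleton] at hy
      rcases hy with rfl | rfl | rfl
      · exact absurd rfl hya
      · exact hB haB hyB
      · refine hB hyB ?_
        change t (t (t a)) ∈ B
        rwa [h3]
    · refine hB hyB ?_
      change t y ∈ B
      rwa [notMem_support.1 hy]
  have htB' : ∀ x ∈ B, t x ∈ B := fun x hx => by
    rw [← htB]
    exact Set.smul_mem_smul_set hx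
  have hsB : ∀ x ∈ t.support, x ∈ B := by
    intro x hx
    rw [hsupp] at hx
    simp only [Finset.mem_insert, Finset.mem_singleton] at hx
    rcases hx with rfl | rfl | rfl
    · exact haB
    · exact htB' _ haB
    · exact htB' _ (htB' _ haB)
  -- As `B` contains the support of `t`, each generator fixes a point of `B` and hence stabilizes
  -- the block; transitivity then makes `B` everything.
  have hinv : ∀ g : Subgroup.closure S, g • B = B := by
    rintro ⟨g, hg⟩
    have : (g : Perm α) • B = B := by
      induction hg using Subgroup.closure_induction with
      | mem s hs =>
        obtain ⟨x, hx, hxs⟩ := h s hs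
        refine hB (g := ⟨s, Subgroup.subset_closure hs⟩) (hsB x hx) ?_
        change s x ∈ B
        rw [hxs]
        exact hsB x hx
      | one => exact one_smul _ _
      | mul a b _ _ h1 h2 => rw [mul_smul, h2, h1]
      | inv a _ h1 => rw [inv_smul_eq_iff, h1]
    exact this
  refine Set.eq_univ_of_forall fun x => ?_
  obtain ⟨g, hg⟩ := MulAction.exists_smul_eq (Subgroup.closure S) a x
  rw [← hinv g, ← hg]
  exact Set.smul_mem_smul_set haB

end

end Equiv.Perm

namespace RubiksCube

/-! ### Move sequences and their invariants -/

variable {n : ℕ}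

theorem turnFacelet_pos (a : Fin 3) (s : Fin n) (f : Facelet n) :
    (turnFacelet a s f).pos = turnPos a s f.pos := by
  by_cases h : f.pos a = s
  · simp [turnFacelet, turnPos, h, rotFacelet]
  · simp [turnFacelet, turnPos, h]

theorem turnFacelet_inv_pos (a : Fin 3) (s : Fin n) (f : Facelet n) :
    ((turnFacelet a s)⁻¹ f).pos = (turnPos a s)⁻¹ f.pos := by
  rw [Perm.eq_inv_iff_eq, ← turnFacelet_pos, ← Perm.mul_apply, mul_inv_cancel, Perm.one_apply]

theorem Move.onFacelet_pos (m : Move n) (f : Facelet n) :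
    (m.onFacelet f).pos = m.onPos f.pos := by
  unfold Move.onFacelet Move.onPos
  split
  · exact turnFacelet_pos _ _ _
  · exact turnFacelet_inv_pos _ _ _

theorem run_pos (w : List (Move n)) (f : Facelet n) : (run w f).pos = runPos w f.pos := by
  induction w generalizing f with
  | nil => rfl
  | cons m w ih => simp only [run, runPos, Perm.mul_apply, ih, Move.onFacelet_pos]

theorem run_append (u v : List (Move n)) : run (u ++ v) = run v * run u := by
  induction u with
  | nil => simp [run]
  | cons m u ih => simp [run, ih, mul_assoc]

theorem runPos_append (u v : List (Move n)) : runPos (u ++ v) = runPos v * runPos u := by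
  induction u with
  | nil => simp [runPos]
  | cons m u ih => simp [runPos, ih, mul_assoc]

/-- The move that undoes a given move. -/
def Move.inverse (m : Move n) : Move n := ⟨m.axis, m.layer, !m.positive⟩

theorem Move.inverse_onFacelet (m : Move n) : m.inverse.onFacelet = m.onFacelet⁻¹ := by
  obtain ⟨a, s, b⟩ := m
  cases b <;> simp [Move.onFacelet, Move.inverse]

theorem Move.inverse_onPos (m : Move n) : m.inverse.onPos = m.onPos⁻¹ := by
  obtain ⟨a, s, b⟩ := m
  cases b <;> simp [Move.onPos, Move.inverse]

/-- The sequence of moves that undoes a given sequence. -/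
def undo (w : List (Move n)) : List (Move n) := (w.map Move.inverse).reverse

theorem length_undo (w : List (Move n)) : (undo w).length = w.length := by
  simp [undo]

theorem run_undo (w : List (Move n)) : run (undo w) = (run w)⁻¹ := by
  induction w with
  | nil => simp [undo, run]
  | cons m w ih =>
    have : undo (m :: w) = undo w ++ [m.inverse] := by simp [undo]
    rw [this, run_append, ih]
    simp [run, Move.inverse_onFacelet]

theorem runPos_undo (w : List (Move n)) : runPos (undo w) = (runPos w)⁻¹ := by
  induction w with
  | nil => simp [undo, runPos]
  | cons m w ih =>
    have : undo (m :: w) = undo w ++ [m.inverse] := by simp [undo]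
    rw [this, runPos_append, ih]
    simp [runPos, Move.inverse_onPos]

theorem run_eq_prod (w : List (Move n)) : run w = (w.reverse.map Move.onFacelet).prod := by
  induction w with
  | nil => simp [run]
  | cons m w ih => simp [run, ih]

theorem run_flatten_reverse (L : List (List (Move n))) :
    run L.reverse.flatten = (L.map run).prod := by
  induction L with
  | nil => simp [run]
  | cons w L ih => simp [run_append, ih]

theorem Move.onPos_eq_self {m : Move n} {p : Pos n} (h : p m.axis ≠ m.layer) :
    m.onPos p = p := by
  have ht : turnPos m.axis m.layer p = p := by simp [turnPos, h]
  unfold Move.onPos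
  split
  · exact ht
  · rwa [inv_apply_eq_self_iff]

/-- A property of positions that is kept by rotations of the cube is kept by all moves. -/
theorem runPos_induction {P : Pos n → Prop} (h : ∀ a p, P (rotPos a p) ↔ P p)
    (w : List (Move n)) (p : Pos n) : P (runPos w p) ↔ P p := by
  have ht (a : Fin 3) (s : Fin n) (p : Pos n) : P (turnPos a s p) ↔ P p := by
    by_cases hp : p a = s
    · simp [turnPos, hp, h]
    · simp [turnPos, hp]
  have hm (m : Move n) (p : Pos n) : P (m.onPos p) ↔ P p := by
    unfold Move.onPos
    split
    · exact ht _ _ _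
    · rw [← ht m.axis m.layer, ← Perm.mul_apply, mul_inv_cancel, Perm.one_apply]
  induction w generalizing p with
  | nil => rfl
  | cons m w ih => exact (ih _).trans (hm m p)

/-- A property of facelets that is kept by rotations of the cube is kept by all moves. -/
theorem run_induction {P : Facelet n → Prop} (h : ∀ a f, P (rotFacelet a f) ↔ P f)
    (w : List (Move n)) (f : Facelet n) : P (run w f) ↔ P f := by
  have ht (a : Fin 3) (s : Fin n) (f : Facelet n) : P (turnFacelet a s f) ↔ P f := by
    by_cases hp : f.pos a = s
    · simp [turnFacelet, hp, h]
    · simp [turnFacelet, hp]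
  have hm (m : Move n) (f : Facelet n) : P (m.onFacelet f) ↔ P f := by
    unfold Move.onFacelet
    split
    · exact ht _ _ _
    · rw [← ht m.axis m.layer, ← Perm.mul_apply, mul_inv_cancel, Perm.one_apply]
  induction w generalizing f with
  | nil => rfl
  | cons m w ih => exact (ih _).trans (hm m f)

theorem visible_rot (a : Fin 3) (p : Pos n) : Visible (rotPos a p) ↔ Visible p := by
  constructor
  · rintro ⟨F, hF⟩
    refine ⟨(rotFace a).symm F, ?_⟩
    rw [← onFace_rot a]
    simpa using hF
  · rintro ⟨F, hF⟩
    exact ⟨rotFace a F, (onFace_rot a p F).2 hF⟩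

/-! ### Clusters are invariant and bounded -/

section Cluster

variable {C : Finset (Pos n)} (hC : IsCluster C)
include hC

theorem IsCluster.runPos_mem_iff (w : List (Move n)) (q : Pos n) : runPos w q ∈ C ↔ q ∈ C := by
  obtain ⟨p, -, h⟩ := hC
  have key (w : List (Move n)) (q : Pos n) (hq : q ∈ C) : runPos w q ∈ C := by
    obtain ⟨u, rfl⟩ := (h q).1 hq
    exact (h _).2 ⟨u ++ w, by rw [runPos_append, Perm.mul_apply]⟩
  refine ⟨fun hq => ?_, key w q⟩
  have := key (undo w) _ hq
  rwa [runPos_undo, ← Perm.mul_apply, inv_mul_cancel, Perm.one_apply] at this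

theorem IsCluster.run_mem_iff (w : List (Move n)) (f : Facelet n) :
    (run w f).pos ∈ C ↔ f.pos ∈ C := by
  rw [run_pos, hC.runPos_mem_iff]

theorem IsCluster.exists_runPos {p q : Pos n} (hp : p ∈ C) (hq : q ∈ C) :
    ∃ w : List (Move n), runPos w p = q := by
  obtain ⟨p0, -, h⟩ := hC
  obtain ⟨u, rfl⟩ := (h p).1 hp
  obtain ⟨v, rfl⟩ := (h q).1 hq
  exact ⟨undo u ++ v, by simp [runPos_append, runPos_undo]⟩

theorem IsCluster.visible {q : Pos n} (hq : q ∈ C) : Visible q := by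
  obtain ⟨p, hp, h⟩ := hC
  obtain ⟨w, rfl⟩ := (h q).1 hq
  exact (runPos_induction visible_rot w p).2 hp

theorem IsCluster.nonempty : C.Nonempty := by
  obtain ⟨p, -, h⟩ := hC
  exact ⟨p, (h p).2 ⟨[], rfl⟩⟩

theorem IsCluster.exists_facelet {q : Pos n} (hq : q ∈ C) : ∃ f : Facelet n, f.pos = q := by
  obtain ⟨F, hF⟩ := hC.visible hq
  exact ⟨⟨(q, F), hF⟩, rfl⟩

theorem IsCluster.turnPos_mem {q : Pos n} (hq : q ∈ C) (a : Fin 3) (s : Fin n) :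
    turnPos a s q ∈ C := by
  have := (hC.runPos_mem_iff [⟨a, s, true⟩] q).2 hq
  simpa [runPos, Move.onPos] using this

theorem IsCluster.rotPos_mem {q : Pos n} (hq : q ∈ C) (a : Fin 3) : rotPos a q ∈ C := by
  have := hC.turnPos_mem hq a (q a)
  simpa [turnPos] using this

/-- Rotations permute coordinates and reflect them, so all coordinates that occur in `C` are among
the at most six values given by one cubie and its reflection; `216 = 6 ^ 3`. -/
theorem IsCluster.card_le : C.card ≤ 216 := by
  classical
  obtain ⟨p, hp⟩ := hC.nonempty
  let S : Finset (Fin n) := {p 0, p 1, p 2, (p 0).rev, (p 1).rev, (p 2).rev}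
  have hrev (x : Fin n) : x.rev ∈ S ↔ x ∈ S := by
    simp only [S, Finset.mem_insert, Finset.mem_singleton, Fin.rev_eq_iff, Fin.rev_rev]
    grind
  have hS : S.card ≤ 6 := Finset.card_le_six
  have hrot (a : Fin 3) (q : Pos n) : (∀ b, rotPos a q b ∈ S) ↔ ∀ b, q b ∈ S := by
    fin_cases a <;> simp [Fin.forall_fin_succ, rotPos, hrev] <;> grind
  have hsub : C ⊆ Fintype.piFinset fun _ => S := by
    intro q hq
    obtain ⟨w, rfl⟩ := hC.exists_runPos hp hq
    rw [Fintype.mem_piFinset]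
    refine (runPos_induction (P := fun q => ∀ b, q b ∈ S) hrot w p).2 ?_
    simp [Fin.forall_fin_succ, S]
  calc C.card ≤ _ := Finset.card_le_card hsub
    _ = S.card ^ 3 := by simp
    _ ≤ 6 ^ 3 := Nat.pow_le_pow_left hS 3
    _ = 216 := by norm_num

end Cluster

/-! ### Local permutations and their bounded length -/

/-- The group generated by the conjugates of the effects of those sequences of at most 8 moves that
leave everything outside `C` in its place. -/
def clusterGroup (C : Finset (Pos n)) : Subgroup (Perm (Facelet n)) :=
  Subgroup.closure {g | ∃ u w : List (Move n), w.length ≤ 8 ∧ AffectsOnly C w ∧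
    g = (run u)⁻¹ * run w * run u}

theorem run_mem_clusterGroup {C : Finset (Pos n)} {w : List (Move n)} (hw : w.length ≤ 8)
    (h : AffectsOnly C w) : run w ∈ clusterGroup C :=
  Subgroup.subset_closure ⟨[], w, hw, h, by simp [run]⟩

theorem conj_mem_clusterGroup {C : Finset (Pos n)} {t : Perm (Facelet n)}
    (ht : t ∈ clusterGroup C) (v : List (Move n)) :
    (run v)⁻¹ * t * run v ∈ clusterGroup C := by
  induction ht using Subgroup.closure_induction with
  | mem g hg =>
    obtain ⟨u, w, hw, h, rfl⟩ := hg
    refine Subgroup.subset_closure ⟨v ++ u, w, hw, h, ?_⟩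
    rw [run_append]
    group
  | one => simp
  | mul a b _ _ h1 h2 =>
    convert mul_mem h1 h2 using 1
    group
  | inv a _ h1 =>
    convert inv_mem h1 using 1
    group

theorem AffectsOnly.run_inv {C : Finset (Pos n)} {w : List (Move n)} (h : AffectsOnly C w)
    {f : Facelet n} (hf : f.pos ∉ C) : (run w)⁻¹ f = f :=
  (inv_apply_eq_self_iff _ _).2 (h f hf)

theorem AffectsOnly.undo {C : Finset (Pos n)} {w : List (Move n)} (h : AffectsOnly C w) :
    AffectsOnly C (undo w) := fun f hf => by
  rw [run_undo]
  exact h.run_inv hf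

theorem AffectsOnly.flatten {C : Finset (Pos n)} {L : List (List (Move n))}
    (h : ∀ w ∈ L, AffectsOnly C w) : AffectsOnly C L.flatten := by
  induction L with
  | nil => exact fun f _ => rfl
  | cons w L ih =>
    intro f hf
    rw [List.flatten_cons, run_append, Perm.mul_apply, h w (by simp) f hf]
    exact ih (fun w' hw' => h w' (by simp [hw'])) f hf

/-- The complement of `C` is invariant under moves, so `u` carries a sticker outside `C` to one that
`w` fixes. -/
theorem AffectsOnly.conj {C : Finset (Pos n)} (hC : IsCluster C) {w : List (Move n)}
    (h : AffectsOnly C w) (u : List (Move n)) :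
    AffectsOnly C (u ++ w ++ RubiksCube.undo u) := fun f hf => by
  rw [run_append, run_append, run_undo, Perm.mul_apply, Perm.mul_apply,
    h _ (by rwa [hC.run_mem_iff]), ← Perm.mul_apply, inv_mul_cancel, Perm.one_apply]

section Restrict

variable {C : Finset (Pos n)} (hC : IsCluster C)

/-- The effect of a sequence of moves on the facelets of a cluster. -/
def restrict (w : List (Move n)) : Perm {f : Facelet n // f.pos ∈ C} :=
  (run w).subtypePerm fun f => hC.run_mem_iff w f

theorem prod_restrict_apply (L : List (List (Move n))) (f : {f : Facelet n // f.pos ∈ C}) :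
    (((L.map (restrict hC)).prod f : {f : Facelet n // f.pos ∈ C}) : Facelet n) =
      (L.map run).prod f := by
  induction L with
  | nil => rfl
  | cons w L ih =>
    simp only [List.map_cons, List.prod_cons, Perm.mul_apply, ← ih]
    rfl

include hC in
-- A cubie has at most six facelets, and `216 * 6 = 1296`. This crude bound is what makes the final
-- constant independent of `n`.
theorem IsCluster.card_perm_facelet_le [Fintype (Perm {f : Facelet n // f.pos ∈ C})] :
    Fintype.card (Perm {f : Facelet n // f.pos ∈ C}) ≤ Nat.factorial 1296 := by
  classical
  have h : Fintype.card {f : Facelet n // f.pos ∈ C} ≤ 1296 := by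
    have hinj : Function.Injective
        (fun f : {f : Facelet n // f.pos ∈ C} => ((⟨f.1.pos, f.2⟩ : C), f.1.face)) := by
      intro f g hfg
      rw [Prod.mk.injEq, Subtype.mk.injEq] at hfg
      exact Subtype.ext (Subtype.ext (Prod.ext hfg.1 hfg.2))
    calc _ ≤ Fintype.card (C × Face) := Fintype.card_le_of_injective _ hinj
      _ = C.card * 6 := by simp [Face]
      _ ≤ 216 * 6 := Nat.mul_le_mul_right 6 hC.card_le
      _ = 1296 := by norm_num
  rw [← Nat.card_eq_fintype_card, Nat.card_perm, Nat.card_eq_fintype_card]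
  exact Nat.factorial_le h

include hC in
/-- The effect of a sequence of moves on a cluster is that of a sequence of bounded length. -/
theorem IsCluster.exists_short_run (u : List (Move n)) :
    ∃ u' : List (Move n), u'.length ≤ Nat.factorial 1296 ∧
      ∀ f : Facelet n, f.pos ∈ C → run u' f = run u f := by
  let _ := Fintype.ofFinite (Perm {f : Facelet n // f.pos ∈ C})
  have hmap (l : List (Move n)) : ((l.map fun m => [m]).map run) = l.map Move.onFacelet := by
    simp [run]
  obtain ⟨l, hl, -, hprod⟩ := exists_list_prod_eq_of_length_le
    -- The list is reversed because sequences run from left to right, while products of permutations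
    -- act from right to left.
    (fun m : Move n => restrict hC [m]) u.reverse
  refine ⟨l.reverse, by simpa using hl.trans hC.card_perm_facelet_le, fun f hf => ?_⟩
  have h (l : List (Move n)) := prod_restrict_apply hC (l.map fun m => [m]) ⟨f, hf⟩
  have h1 := h l
  have h2 := h u.reverse
  rw [List.map_map, hmap] at h1 h2
  rw [run_eq_prod, run_eq_prod, List.reverse_reverse, ← h1, ← h2]
  exact congrArg (fun g : Perm {f : Facelet n // f.pos ∈ C} => (g ⟨f, hf⟩ : Facelet n)) hprod

include hC in
/-- Every element of the cluster group is the effect of a sequence of bounded length. -/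
theorem IsCluster.exists_short_of_mem_clusterGroup {t : Perm (Facelet n)}
    (ht : t ∈ clusterGroup C) :
    ∃ w : List (Move n),
      w.length ≤ Nat.factorial 1296 * (2 * Nat.factorial 1296 + 8) ∧ AffectsOnly C w ∧
        run w = t := by
  let _ := Fintype.ofFinite (Perm {f : Facelet n // f.pos ∈ C})
  obtain ⟨L, hL, rfl⟩ : ∃ L : List (List (Move n)),
      (∀ w ∈ L, w.length ≤ 2 * Nat.factorial 1296 + 8 ∧ AffectsOnly C w) ∧
        (L.map run).prod = t := by
    induction ht using Subgroup.closure_induction with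
    | mem g hg =>
      obtain ⟨u, w, hw, h, rfl⟩ := hg
      -- Since `w` moves nothing outside `C`, its conjugate by `u` depends only on the action of `u`
      -- on `C`.
      obtain ⟨u', hu', huu⟩ := hC.exists_short_run u
      refine ⟨[u' ++ w ++ undo u'], ?_, ?_⟩
      · simp only [List.mem_singleton, forall_eq, List.length_append, length_undo]
        exact ⟨by omega, h.conj hC u'⟩
      · rw [List.map_singleton, List.prod_singleton]
        ext1 f
        by_cases hf : f.pos ∈ C
        · have hw1 : (run w (run u f)).pos ∈ C := by rwa [hC.run_mem_iff, hC.run_mem_iff]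
          have e : (run u')⁻¹ (run w (run u f)) = (run u)⁻¹ (run w (run u f)) := by
            rw [Perm.inv_eq_iff_eq, huu]
            · simp
            · rwa [← run_undo, hC.run_mem_iff]
          simp only [run_append, run_undo, Perm.mul_apply, huu f hf, e]
        · rw [h.conj hC u' f hf]
          have := h.conj hC u f hf
          simpa only [run_append, run_undo, Perm.mul_apply] using this.symm
    | one => exact ⟨[], by simp, by simp⟩
    | mul a b _ _ h1 h2 =>
      obtain ⟨L1, h1, rfl⟩ := h1
      obtain ⟨L2, h2, rfl⟩ := h2
      refine ⟨L1 ++ L2, fun w hw => ?_, by simp⟩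
      rcases List.mem_append.1 hw with h | h
      · exact h1 w h
      · exact h2 w h
    | inv a _ h1 =>
      obtain ⟨L, h, rfl⟩ := h1
      refine ⟨(L.map undo).reverse, fun w hw => ?_, ?_⟩
      · simp only [List.mem_reverse, List.mem_map] at hw
        obtain ⟨w', hw', rfl⟩ := hw
        rw [length_undo]
        exact ⟨(h w' hw').1, (h w' hw').2.undo⟩
      · rw [List.prod_inv_reverse, List.map_reverse, List.map_map, List.map_map]
        congr 2
        exact List.map_congr_left fun w _ => run_undo w
  -- Now the number of factors is bounded. The surviving factors belong to `L`, so they stay short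
  -- and local; equality of the products on `C` is enough, as both are trivial elsewhere.
  obtain ⟨L', hL', hmem, hprod⟩ := exists_list_prod_eq_of_length_le (restrict hC) L
  have haff : ∀ L : List (List (Move n)), (∀ w ∈ L, AffectsOnly C w) →
      AffectsOnly C L.reverse.flatten := fun L h =>
    AffectsOnly.flatten fun w hw => h w (by simpa using hw)
  refine ⟨L'.reverse.flatten, ?_, haff _ fun w hw => (hL w (hmem w hw)).2, ?_⟩
  · have h1 : ∀ L : List (List (Move n)), (∀ w ∈ L, w.length ≤ 2 * Nat.factorial 1296 + 8) →
        L.flatten.length ≤ L.length * (2 * Nat.factorial 1296 + 8) := by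
      intro L
      induction L with
      | nil => simp
      | cons w L ih =>
        intro h
        have h2 := ih fun w' hw' => h w' (by simp [hw'])
        have h3 := h w (by simp)
        rw [List.flatten_cons, List.length_append, List.length_cons, add_mul, one_mul]
        omega
    refine (h1 _ fun w hw => (hL w (hmem w (by simpa using hw))).1).trans ?_
    rw [List.length_reverse]
    exact Nat.mul_le_mul_right _ (hL'.trans hC.card_perm_facelet_le)
  · ext1 f
    by_cases hf : f.pos ∈ C
    · rw [run_flatten_reverse, ← prod_restrict_apply hC L' ⟨f, hf⟩,
        ← prod_restrict_apply hC L ⟨f, hf⟩, hprod]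
    · rw [haff L' (fun w hw => (hL w (hmem w hw)).2) f hf, ← run_flatten_reverse,
        haff L (fun w hw => (hL w hw).2) f hf]

end Restrict

/-- The effects of move sequences that act on `C` like an element of the cluster group. -/
def localGroup {C : Finset (Pos n)} (hC : IsCluster C) : Subgroup (Perm (Facelet n)) where
  carrier := {g | (∃ w, run w = g) ∧ ∃ t ∈ clusterGroup C, ∀ f : Facelet n, f.pos ∈ C → t f = g f}
  one_mem' := ⟨⟨[], rfl⟩, 1, one_mem _, fun _ _ => rfl⟩
  mul_mem' := by
    rintro a b ⟨⟨u, rfl⟩, s, hs, hsa⟩ ⟨⟨v, rfl⟩, t, ht, htb⟩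
    refine ⟨⟨v ++ u, run_append _ _⟩, s * t, mul_mem hs ht, fun f hf => ?_⟩
    rw [Perm.mul_apply, Perm.mul_apply, htb f hf, hsa _ ((hC.run_mem_iff v f).2 hf)]
  inv_mem' := by
    rintro a ⟨⟨u, rfl⟩, s, hs, hsa⟩
    refine ⟨⟨undo u, run_undo _⟩, s⁻¹, inv_mem hs, fun f hf => ?_⟩
    rw [Perm.inv_eq_iff_eq, hsa, ← Perm.mul_apply, mul_inv_cancel, Perm.one_apply]
    rwa [← run_undo, hC.run_mem_iff]

section

variable {C : Finset (Pos n)} (hC : IsCluster C)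

theorem conj_mem_localGroup {g : Perm (Facelet n)} (hg : g ∈ localGroup hC)
    (v : List (Move n)) : (run v)⁻¹ * g * run v ∈ localGroup hC := by
  obtain ⟨⟨u, rfl⟩, t, ht, h⟩ := hg
  refine ⟨⟨v ++ u ++ undo v, by rw [run_append, run_append, run_undo, mul_assoc]⟩, _,
    conj_mem_clusterGroup ht v, fun f hf => ?_⟩
  simp only [Perm.mul_apply]
  rw [h _ ((hC.run_mem_iff v f).2 hf)]

theorem run_mem_localGroup {w : List (Move n)} (hw : w.length ≤ 8) (h : AffectsOnly C w) :
    run w ∈ localGroup hC :=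
  ⟨⟨w, rfl⟩, _, run_mem_clusterGroup hw h, fun _ _ => rfl⟩

/-- Membership is decided by the action on `C` alone, so a sequence that scrambles the other
clusters may belong to the local group. -/
theorem mem_localGroup_of_eq_on {w : List (Move n)} {g : Perm (Facelet n)}
    (hg : g ∈ localGroup hC) (h : ∀ f : Facelet n, f.pos ∈ C → run w f = g f) :
    run w ∈ localGroup hC := by
  obtain ⟨-, t, ht, h'⟩ := hg
  exact ⟨⟨w, rfl⟩, t, ht, fun f hf => (h' f hf).trans (h f hf).symm⟩

end

/-! ### The commutator that cycles three cubies -/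

theorem rotPos_zero (p : Pos n) : rotPos 0 p = ![p 0, (p 2).rev, p 1] := by
  funext b; fin_cases b <;> simp [rotPos]

theorem rotPos_one (p : Pos n) : rotPos 1 p = ![p 2, p 1, (p 0).rev] := by
  funext b; fin_cases b <;> simp [rotPos]

theorem rotPos_two (p : Pos n) : rotPos 2 p = ![(p 1).rev, p 0, p 2] := by
  funext b; fin_cases b <;> simp [rotPos]

theorem turnPos_inv_of_eq {a : Fin 3} {s : Fin n} {p : Pos n} (h : p a = s) :
    (turnPos a s)⁻¹ p = (rotPos a).symm p := by
  change (turnPos a s).symm p = _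
  simp [turnPos, h]

theorem turnPos_of_eq {a : Fin 3} {s : Fin n} {p : Pos n} (h : p a = s) :
    turnPos a s p = rotPos a p := by
  simp [turnPos, h]

theorem turnPos_of_ne {a : Fin 3} {s : Fin n} {p : Pos n} (h : p a ≠ s) :
    turnPos a s p = p := by
  simp [turnPos, h]

theorem turnFacelet_of_ne {a : Fin 3} {s : Fin n} {f : Facelet n} (h : f.pos a ≠ s) :
    turnFacelet a s f = f := by
  simp [turnFacelet, h]

/-- The commutator of the slice `x_0 = a` with the conjugate by a turn of the face `x_2 = top` of
the slice `x_0 = c`. -/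
def threeCycleWord (a c top : Fin n) : List (Move n) :=
  [⟨2, top, false⟩, ⟨0, c, true⟩, ⟨2, top, true⟩, ⟨0, a, false⟩,
    ⟨2, top, false⟩, ⟨0, c, false⟩, ⟨2, top, true⟩, ⟨0, a, true⟩]

theorem run_threeCycleWord (a c top : Fin n) :
    run (threeCycleWord a c top) = turnFacelet 0 a *
      (turnFacelet 2 top * (turnFacelet 0 c)⁻¹ * (turnFacelet 2 top)⁻¹) * (turnFacelet 0 a)⁻¹ *
      (turnFacelet 2 top * (turnFacelet 0 c)⁻¹ * (turnFacelet 2 top)⁻¹)⁻¹ := by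
  simp [threeCycleWord, run, Move.onFacelet, mul_assoc]

theorem conj_apply_ne_self_iff {α : Type*} (g h : Perm α) (x : α) :
    (g * h * g⁻¹) x ≠ x ↔ h (g⁻¹ x) ≠ g⁻¹ x := by
  rw [Perm.mul_apply, Perm.mul_apply, not_iff_not, ← Perm.eq_inv_iff_eq]

/-- The two factors of the commutator overlap in only one cubie. -/
theorem eq_of_turnPos_ne {a c top : Fin n} (hac : a ≠ c) {p : Pos n} (h1 : p 0 = a)
    (h2 : ((turnPos 2 top)⁻¹ p) 0 = c) : p = ![a, c, top] := by
  by_cases h : p 2 = top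
  · rw [turnPos_inv_of_eq h] at h2
    have h3 : (rotPos 2).symm p 0 = p 1 := by simp [rotPos]
    rw [h3] at h2
    funext b
    fin_cases b <;> simp [h, h1, h2]
  · have : (turnPos 2 top)⁻¹ p = p := (inv_apply_eq_self_iff _ _).2 (turnPos_of_ne h)
    rw [this, h1] at h2
    exact absurd h2 hac

/-- A facelet moved by both factors of the commutator belongs to the cubie at `![a, c, top]`. The
argument runs on facelets, so it also excludes twists outside `C`. -/
theorem affectsOnly_threeCycleWord {C : Finset (Pos n)} (hC : IsCluster C) {a c top : Fin n}
    (hac : a ≠ c) (hq : ![a, c, top] ∈ C) : AffectsOnly C (threeCycleWord a c top) := by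
  intro f hf
  rw [run_threeCycleWord]
  have hA : ((turnFacelet 0 a)⁻¹ f).pos ∉ C := by
    have := hC.run_mem_iff [⟨0, a, false⟩] f
    simp only [run, Move.onFacelet] at this
    exact fun h => hf (this.1 h)
  have hB : ((turnFacelet 2 top * (turnFacelet 0 c)⁻¹ * (turnFacelet 2 top)⁻¹)⁻¹ f).pos ∉ C := by
    have := hC.run_mem_iff [⟨2, top, false⟩, ⟨0, c, true⟩, ⟨2, top, true⟩] f
    simp [run, Move.onFacelet] at this
    intro h
    simp [mul_assoc] at h
    exact hf (this.1 h)
  refine commutator_apply_eq_self (P := fun f => f.pos ∈ C) (fun g h1 h2 => ?_) hf hA hB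
  rw [conj_apply_ne_self_iff, Ne, inv_apply_eq_self_iff] at h2
  have h1' : g.pos 0 = a := by
    by_contra h
    exact h1 (turnFacelet_of_ne h)
  have h2' : ((turnPos 2 top)⁻¹ g.pos) 0 = c := by
    rw [← turnFacelet_inv_pos]
    by_contra h
    exact h2 (turnFacelet_of_ne h)
  rwa [eq_of_turnPos_ne hac h1' h2']

section

variable {C : Finset (Pos n)} (hC : IsCluster C)

/-- The effect of a sequence of moves on the cubies of a cluster. -/
def restrictPos (w : List (Move n)) : Perm C :=
  (runPos w).subtypePerm fun p => hC.runPos_mem_iff w p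

theorem realizes_restrictPos (w : List (Move n)) : Realizes w (restrictPos hC w) := fun _ => rfl

theorem Realizes.eq_restrictPos {w : List (Move n)} {π : Perm C} (h : Realizes w π) :
    π = restrictPos hC w := by
  ext p
  rw [← h p, ← realizes_restrictPos hC w p]

theorem restrictPos_append (u v : List (Move n)) :
    restrictPos hC (u ++ v) = restrictPos hC v * restrictPos hC u := by
  refine Equiv.ext fun p => Subtype.ext ?_
  change runPos (u ++ v) p = runPos v (runPos u p)
  rw [runPos_append, Perm.mul_apply]

theorem restrictPos_undo (u : List (Move n)) :
    restrictPos hC (undo u) = (restrictPos hC u)⁻¹ := by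
  rw [eq_inv_iff_mul_eq_one]
  refine Equiv.ext fun p => Subtype.ext ?_
  change runPos (undo u) (runPos u p) = p
  rw [runPos_undo, ← Perm.mul_apply, inv_mul_cancel, Perm.one_apply]

theorem restrictPos_nil : restrictPos hC [] = 1 := rfl

theorem restrictPos_mem_closure (w : List (Move n)) :
    restrictPos hC w ∈ Subgroup.closure (Set.range fun m : Move n => restrictPos hC [m]) := by
  induction w with
  | nil => exact one_mem _
  | cons m w ih =>
    rw [← List.singleton_append, restrictPos_append]
    exact mul_mem ih (Subgroup.subset_closure ⟨m, rfl⟩)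

theorem exists_restrictPos_of_mem_closure {g : Perm C}
    (hg : g ∈ Subgroup.closure (Set.range fun m : Move n => restrictPos hC [m])) :
    ∃ w, restrictPos hC w = g := by
  induction hg using Subgroup.closure_induction with
  | mem g hg => exact ⟨_, hg.choose_spec⟩
  | one => exact ⟨[], rfl⟩
  | mul a b _ _ h1 h2 =>
    obtain ⟨u, rfl⟩ := h1
    obtain ⟨v, rfl⟩ := h2
    exact ⟨v ++ u, restrictPos_append hC _ _⟩
  | inv a _ h1 =>
    obtain ⟨u, rfl⟩ := h1
    exact ⟨undo u, restrictPos_undo hC _⟩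

/-- The permutations of the cubies of `C` that come from the local group. -/
def localPerms : Subgroup (Perm C) where
  carrier := {π | ∃ w, run w ∈ localGroup hC ∧ restrictPos hC w = π}
  one_mem' := ⟨[], one_mem _, rfl⟩
  mul_mem' := by
    rintro _ _ ⟨u, hu, rfl⟩ ⟨v, hv, rfl⟩
    exact ⟨v ++ u, by rw [run_append]; exact mul_mem hu hv, restrictPos_append hC _ _⟩
  inv_mem' := by
    rintro _ ⟨u, hu, rfl⟩
    exact ⟨undo u, by rw [run_undo]; exact inv_mem hu, restrictPos_undo hC _⟩

/-- The factors `A` and `B` overlap only in the cubie `q`, so the commutator cycles `q`, `A q` and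
`B q`. These lie at `![a, c, top]`, `![a, top.rev, c]` and `![c, top, a]`, which no slice contains
all at once; hence every move fixes one of them, as the primitivity criterion demands. -/
theorem restrictPos_threeCycleWord {a c top : Fin n} (htop : (top : ℕ) + 1 = n) (hac : a ≠ c)
    (hat : a ≠ top) (hq : ![a, c, top] ∈ C) :
    (restrictPos hC (threeCycleWord a c top)).IsThreeCycle ∧
      ∀ m : Move n, ∃ x ∈ (restrictPos hC (threeCycleWord a c top)).support,
        restrictPos hC [m] x = x := by
  have hn : 2 ≤ n := by
    have := Fin.val_ne_of_ne hat
    omega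
  have hrt : top.rev ≠ top := fun h => by
    have := congrArg Fin.val h
    rw [Fin.val_rev] at this
    omega
  let A : Perm C := restrictPos hC [⟨0, a, true⟩]
  let B : Perm C := restrictPos hC [⟨2, top, false⟩, ⟨0, c, false⟩, ⟨2, top, true⟩]
  let q : C := ⟨![a, c, top], hq⟩
  have hAv (x : C) : ((A x : C) : Pos n) = turnPos 0 a x := by
    simp [A, restrictPos, runPos, Move.onPos]
  have hBv (x : C) : ((B x : C) : Pos n) =
      (turnPos 2 top * (turnPos 0 c)⁻¹ * (turnPos 2 top)⁻¹) x := by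
    simp [B, restrictPos, runPos, Move.onPos]
  have hAq : ((A q : C) : Pos n) = ![a, top.rev, c] := by
    rw [hAv, turnPos_of_eq (by simp [q]), rotPos_zero]
    simp [q]
  have hBq : ((B q : C) : Pos n) = ![c, top, a] := by
    rw [hBv, Perm.mul_apply, Perm.mul_apply, turnPos_inv_of_eq (a := 2) (p := (q : Pos n)) (by simp [q])]
    have h1 : (rotPos 2).symm (q : Pos n) = ![c, a.rev, top] := by
      rw [Equiv.symm_apply_eq, rotPos_two]
      simp [q]
    have h2 : (rotPos 0).symm ![c, a.rev, top] = ![c, top, a] := by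
      rw [Equiv.symm_apply_eq, rotPos_zero]
      simp
    rw [h1, turnPos_inv_of_eq (by simp), h2, turnPos_of_ne (by simpa using hat)]
  have hAne : A q ≠ q := fun h => by
    have h1 : ![a, top.rev, c] = ![a, c, top] := by rw [← hAq, h]
    have h2 := congrFun h1 1
    have h3 := congrFun h1 2
    simp at h2 h3
    exact hrt (h2.trans h3)
  have hBne : B q ≠ q := fun h => by
    have h1 : ![c, top, a] = ![a, c, top] := by rw [← hBq, h]
    exact hac (congrFun h1 0).symm
  have hover (x : C) (h1 : A x ≠ x) (h2 : B x ≠ x) : x = q := by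
    rw [Ne, Subtype.ext_iff, hAv] at h1
    rw [Ne, Subtype.ext_iff, hBv, ← Ne, conj_apply_ne_self_iff, Ne, inv_apply_eq_self_iff] at h2
    refine Subtype.ext (eq_of_turnPos_ne hac ?_ ?_)
    · by_contra h
      exact h1 (turnPos_of_ne h)
    · by_contra h
      exact h2 (turnPos_of_ne h)
  have hw : restrictPos hC (threeCycleWord a c top) = A * B * A⁻¹ * B⁻¹ := by
    rw [← restrictPos_undo, ← restrictPos_undo, ← restrictPos_append, ← restrictPos_append,
      ← restrictPos_append]
    rfl
  obtain ⟨hne, hcomm⟩ := commutator_eq_swap_mul_swap hover hAne hBne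
  have hthree := isThreeCycle_swap_mul_swap_same hBne.symm hAne.symm hne.symm
  rw [← hcomm, ← hw] at hthree
  refine ⟨hthree, fun m => ?_⟩
  have hsupp : ∀ x : C, x = q ∨ x = A q ∨ x = B q →
      x ∈ (restrictPos hC (threeCycleWord a c top)).support := by
    intro x hx
    rw [hw, hcomm, mem_support, Perm.mul_apply]
    rcases hx with rfl | rfl | rfl
    · rw [swap_apply_left, swap_apply_of_ne_of_ne hAne hne]
      exact hAne
    · rw [swap_apply_right, swap_apply_left]
      exact hne.symm
    · rw [swap_apply_of_ne_of_ne hBne hne.symm, swap_apply_right]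
      exact hBne.symm
  have hfix (x : C) (h : (x : Pos n) m.axis ≠ m.layer) : restrictPos hC [m] x = x := by
    apply Subtype.ext
    change runPos [m] x = x
    simpa [runPos] using Move.onPos_eq_self h
  by_contra! hcon
  have hall (x : C) (hx : x = q ∨ x = A q ∨ x = B q) : (x : Pos n) m.axis = m.layer := by
    by_contra h
    exact hcon x (hsupp x hx) (hfix x h)
  have e1 := hall q (Or.inl rfl)
  have e2 := hall (A q) (Or.inr (Or.inl rfl))
  have e3 := hall (B q) (Or.inr (Or.inr rfl))
  rw [hAq] at e2
  rw [hBq] at e3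
  simp only [q] at e1
  generalize m.axis = d at e1 e2 e3
  generalize m.layer = s at e1 e2 e3
  fin_cases d
  · exact hac (e1.trans e3.symm)
  · exact hrt (e2.trans e3.symm)
  · exact hat (e3.trans e1.symm)

/-- Every even permutation of the cubies comes from the local group, given a suitable cubie. -/
theorem alternatingGroup_le_localPerms {a c top : Fin n} (htop : (top : ℕ) + 1 = n) (hac : a ≠ c)
    (hat : a ≠ top) (hq : ![a, c, top] ∈ C) : alternatingGroup C ≤ localPerms hC := by
  obtain ⟨h3, hfix⟩ := restrictPos_threeCycleWord hC htop hac hat hq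
  set t := restrictPos hC (threeCycleWord a c top) with ht
  let S : Set (Perm C) := Set.range fun m : Move n => restrictPos hC [m]
  have hpre : MulAction.IsPretransitive (Subgroup.closure S) C := by
    refine ⟨fun x y => ?_⟩
    obtain ⟨w, hw⟩ := hC.exists_runPos x.2 y.2
    exact ⟨⟨_, restrictPos_mem_closure hC w⟩, Subtype.ext hw⟩
  have hprim : MulAction.IsPreprimitive (Subgroup.closure S) C :=
    isPreprimitive_closure_of_isThreeCycle h3 (restrictPos_mem_closure hC _) (by
      rintro _ ⟨m, rfl⟩
      exact hfix m)
  -- Jordan's theorem, for the group of all moves. What it gives for local sequences is that every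
  -- even permutation is available as a conjugator, and conjugation by moves preserves the local
  -- group.
  have hle := alternatingGroup_le_of_isPreprimitive_of_isThreeCycle_mem hprim h3
    (restrictPos_mem_closure hC _)
  refine alternatingGroup_le_of_conj_mem h3 ⟨_, run_mem_localGroup hC (le_of_eq rfl)
    (affectsOnly_threeCycleWord hC hac hq), rfl⟩ ?_
  rintro g hg _ ⟨w, hw, rfl⟩
  obtain ⟨u, rfl⟩ := exists_restrictPos_of_mem_closure hC (hle hg)
  refine ⟨undo u ++ w ++ u, ?_, ?_⟩
  · have := conj_mem_localGroup hC hw (undo u)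
    rw [run_undo, inv_inv] at this
    rwa [run_append, run_append, run_undo, ← mul_assoc]
  · rw [restrictPos_append, restrictPos_append, restrictPos_undo, mul_assoc]

end

/-- A cluster other than that of the face midpoints has a cubie on the face `x_2 = n - 1` to which
the commutator applies. -/
theorem IsCluster.exists_mem_top_face {C : Finset (Pos n)} (hC : IsCluster C) (hn : 2 ≤ n)
    (hmid : ∀ p ∈ C, ¬ IsFaceMidpoint p) :
    ∃ a c top : Fin n, (top : ℕ) + 1 = n ∧ a ≠ c ∧ a ≠ top ∧ ![a, c, top] ∈ C := by
  obtain ⟨p, hp⟩ := hC.nonempty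
  obtain ⟨q, hq, htop⟩ : ∃ q ∈ C, (q 2 : ℕ) + 1 = n := by
    have h0 : ∀ q ∈ C, (q 1 : ℕ) + 1 = n → ∃ q ∈ C, (q 2 : ℕ) + 1 = n := fun q hq h =>
      ⟨_, hC.rotPos_mem hq 0, by simpa [rotPos_zero] using h⟩
    have h1 : ∀ q ∈ C, (q 0 : ℕ) + 1 = n → ∃ q ∈ C, (q 2 : ℕ) + 1 = n := fun q hq h =>
      h0 _ (hC.rotPos_mem hq 2) (by simpa [rotPos_two] using h)
    have hr (x : Fin n) (hx : (x : ℕ) = 0) : (x.rev : ℕ) + 1 = n := by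
      rw [Fin.val_rev]; omega
    obtain ⟨⟨d, t⟩, hF⟩ := hC.visible hp
    fin_cases d <;> cases t <;> simp [OnFace] at hF
    · exact ⟨_, hC.rotPos_mem hp 1, by simpa [rotPos_one] using hr _ hF⟩
    · exact h1 p hp hF
    · exact h1 _ (hC.rotPos_mem hp 2) (by simpa [rotPos_two] using hr _ hF)
    · exact h0 p hp hF
    · exact h0 _ (hC.rotPos_mem hp 0) (by simpa [rotPos_zero] using hr _ hF)
    · exact ⟨p, hp, hF⟩
  have hq0 : ![q 0, q 1, q 2] ∈ C := by
    convert hq using 1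
    funext b; fin_cases b <;> rfl
  have hq1 := hC.rotPos_mem hq0 2
  have hq2 := hC.rotPos_mem hq1 2
  have hq3 := hC.rotPos_mem hq2 2
  simp [rotPos_two] at hq1 hq2 hq3
  have hm : ¬ (2 * (q 0 : ℕ) + 1 = n ∧ 2 * (q 1 : ℕ) + 1 = n) := by
    rintro ⟨h0, h1⟩
    refine hmid q hq ⟨(2, true), by simpa [OnFace] using htop, fun b => ?_⟩
    fin_cases b
    · simpa using h0
    · simpa using h1
    · simp; omega
  have h0 := (q 0).isLt
  have h1 := (q 1).isLt
  generalize q 0 = a, q 1 = c, q 2 = top at *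
  -- The quarter turns of the top face give the pairs `(a, c)`, `(c.rev, a)`, `(a.rev, c.rev)` and
  -- `(c, a.rev)`. If all four are unsuitable, then `a = c` is the middle coordinate, which `hm`
  -- excludes.
  by_contra hcon
  have key (x y : Fin n) (h : ![x, y, top] ∈ C) : (x : ℕ) = y ∨ (x : ℕ) = top := by
    by_contra! h'
    exact hcon ⟨x, y, top, htop, fun e => h'.1 (congrArg Fin.val e),
      fun e => h'.2 (congrArg Fin.val e), h⟩
  have k0 := key a c hq0
  have k1 := key c.rev a hq1
  have k2 := key a.rev c.rev hq2
  have k3 := key c a.rev hq3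
  rw [Fin.val_rev] at k1 k2 k3
  rw [Fin.val_rev] at k2
  omega

/-! ### Orientation of centers and wings -/

theorem rotFacelet_pos (a : Fin 3) (f : Facelet n) : (rotFacelet a f).pos = rotPos a f.pos := rfl

theorem rotFacelet_face (a : Fin 3) (f : Facelet n) :
    (rotFacelet a f).face = rotFace a f.face := rfl

/-- A coordinate is extremal if it is `0` or `n - 1`. -/
def extremal (x : Fin n) : Bool := decide ((x : ℕ) = 0 ∨ (x : ℕ) + 1 = n)

/-- A coordinate lies in the lower half of the cube. -/
def lowerHalf (x : Fin n) : Bool := decide (2 * (x : ℕ) + 1 < n)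

/-- A coordinate is that of the middle slice. -/
def middle (x : Fin n) : Bool := decide (2 * (x : ℕ) + 1 = n)

theorem extremal_rev (x : Fin n) : extremal x.rev = extremal x := by
  have := x.isLt
  simp only [extremal, Fin.val_rev, decide_eq_decide]
  omega

theorem middle_rev (x : Fin n) : middle x.rev = middle x := by
  have := x.isLt
  simp only [middle, Fin.val_rev, decide_eq_decide]
  omega

theorem lowerHalf_rev {x : Fin n} (h : middle x = false) : lowerHalf x.rev = !lowerHalf x := by
  have := x.isLt
  simp only [middle, decide_eq_false_iff_not] at h
  simp only [lowerHalf, Fin.val_rev, ← decide_not, decide_eq_decide]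
  omega

/-- The edge cubies that are not in a middle slice. -/
def IsWing (p : Pos n) : Prop :=
  (middle (p 0) = false ∧ middle (p 1) = false ∧ middle (p 2) = false) ∧
    ((extremal (p 0) = false ∧ extremal (p 1) = true ∧ extremal (p 2) = true) ∨
      (extremal (p 0) = true ∧ extremal (p 1) = false ∧ extremal (p 2) = true) ∨
      (extremal (p 0) = true ∧ extremal (p 1) = true ∧ extremal (p 2) = false))

/-- The cubies with only one side on the surface of the cube. -/
def IsCenter (p : Pos n) : Prop :=
  (extremal (p 0) = true ∧ extremal (p 1) = false ∧ extremal (p 2) = false) ∨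
    (extremal (p 0) = false ∧ extremal (p 1) = true ∧ extremal (p 2) = false) ∨
      (extremal (p 0) = false ∧ extremal (p 1) = false ∧ extremal (p 2) = true)

theorem isWing_rot (a : Fin 3) (p : Pos n) : IsWing (rotPos a p) ↔ IsWing p := by
  fin_cases a <;> simp [IsWing, rotPos, middle_rev, extremal_rev] <;> tauto

theorem isCenter_rot (a : Fin 3) (p : Pos n) : IsCenter (rotPos a p) ↔ IsCenter p := by
  fin_cases a <;> simp [IsCenter, rotPos, extremal_rev] <;> tauto

/-- The handedness of a facelet of a wing, which no rotation of the cube changes. -/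
def chirality (p : Pos n) (F : Face) : Bool :=
  F.2 ^^ lowerHalf (p (F.1 + 1)) ^^ lowerHalf (p (F.1 + 2)) ^^ extremal (p (F.1 + 1))

theorem onFace_extremal {p : Pos n} {F : Face} (h : OnFace p F) : extremal (p F.1) = true := by
  obtain ⟨d, t⟩ := F
  cases t <;> simp_all [OnFace, extremal]

theorem onFace_lowerHalf (hn : 2 ≤ n) {p : Pos n} {F : Face} (h : OnFace p F) :
    F.2 = !lowerHalf (p F.1) := by
  obtain ⟨d, t⟩ := F
  cases t <;> simp_all [OnFace, lowerHalf] <;> omega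

/-- The last term of `chirality` records the cyclic order of the face axis, the other extremal axis
and the axis along the edge. A quarter turn exchanges two axes, which reverses this order, and
reflects one coordinate, which flips the sum of the other terms. -/
theorem chirality_rot (a : Fin 3) {p : Pos n} {F : Face} (hp : IsWing p) (hF : OnFace p F) :
    chirality (rotPos a p) (rotFace a F) = chirality p F := by
  have hF := onFace_extremal hF
  obtain ⟨d, t⟩ := F
  obtain ⟨⟨m0, m1, m2⟩, he⟩ := hp
  have r0 := lowerHalf_rev m0
  have r1 := lowerHalf_rev m1
  have r2 := lowerHalf_rev m2
  fin_cases a <;> fin_cases d <;>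
    simp [chirality, rotPos, rotFace, extremal_rev, r0, r1, r2] at hF ⊢ <;>
    rcases he with ⟨e0, e1, e2⟩ | ⟨e0, e1, e2⟩ | ⟨e0, e1, e2⟩ <;>
    simp_all <;>
    cases t <;> cases lowerHalf (p 0) <;> cases lowerHalf (p 1) <;> cases lowerHalf (p 2) <;> rfl

/-- For both facelets of a wing the terms other than the last have the same sum, while exchanging
the roles of the two extremal axes reverses the cyclic order. -/
theorem face_eq_of_chirality_eq (hn : 2 ≤ n) {p : Pos n} (hp : IsWing p) {F F' : Face}
    (hF : OnFace p F) (hF' : OnFace p F') (h : chirality p F = chirality p F') : F = F' := by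
  have h1 := onFace_extremal hF
  have h2 := onFace_lowerHalf hn hF
  have h1' := onFace_extremal hF'
  have h2' := onFace_lowerHalf hn hF'
  obtain ⟨d, t⟩ := F
  obtain ⟨d', t'⟩ := F'
  obtain ⟨-, he⟩ := hp
  simp only at h1 h2 h1' h2'
  subst h2 h2'
  simp only [chirality] at h
  fin_cases d <;> fin_cases d' <;> first
  | rfl
  | simp at h h1 h1'
    rcases he with ⟨e0, e1, e2⟩ | ⟨e0, e1, e2⟩ | ⟨e0, e1, e2⟩ <;> simp_all <;>
    (revert h; cases lowerHalf (p 0) <;> cases lowerHalf (p 1) <;> cases lowerHalf (p 2) <;> simp)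

theorem face_eq_of_isCenter (hn : 2 ≤ n) {p : Pos n} (hp : IsCenter p) {F F' : Face}
    (hF : OnFace p F) (hF' : OnFace p F') : F = F' := by
  have h1 := onFace_extremal hF
  have h2 := onFace_lowerHalf hn hF
  have h1' := onFace_extremal hF'
  have h2' := onFace_lowerHalf hn hF'
  obtain ⟨d, t⟩ := F
  obtain ⟨d', t'⟩ := F'
  simp only at h1 h2 h1' h2'
  subst h2 h2'
  fin_cases d <;> fin_cases d' <;> first
  | rfl
  | simp at h1 h1'
    rcases hp with ⟨e0, e1, e2⟩ | ⟨e0, e1, e2⟩ | ⟨e0, e1, e2⟩ <;> simp_all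

/-- If the position of a facelet together with an invariant determines the facelet, then even move
sequences act on the cluster like elements of the cluster group. -/
theorem run_mem_localGroup_of_invariant {C : Finset (Pos n)} (hC : IsCluster C) (hn : 2 ≤ n)
    (hmid : ∀ p ∈ C, ¬ IsFaceMidpoint p) {P : Facelet n → Prop}
    (hP : ∀ a f, P (rotFacelet a f) ↔ P f)
    (hinj : ∀ f g : Facelet n, f.pos ∈ C → f.pos = g.pos → (P f ↔ P g) → f = g)
    {v : List (Move n)} (hv : EvenOn C v) : run v ∈ localGroup hC := by
  obtain ⟨π, hπ, hsign⟩ := hv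
  obtain ⟨a, c, top, htop, hac, hat, hq⟩ := hC.exists_mem_top_face hn hmid
  obtain ⟨w, hw, rfl⟩ := alternatingGroup_le_localPerms hC htop hac hat hq
    (mem_alternatingGroup.2 hsign)
  refine mem_localGroup_of_eq_on hC hw fun f hf => hinj _ _ ?_ ?_ ?_
  · rwa [hC.run_mem_iff]
  · rw [run_pos, run_pos, hπ ⟨f.pos, hf⟩]
    rfl
  · rw [run_induction hP, run_induction hP]

theorem run_mem_localGroup_of_isCenter {C : Finset (Pos n)} (hC : IsCluster C) (hn : 2 ≤ n)
    (hmid : ∀ p ∈ C, ¬ IsFaceMidpoint p) (hcen : ∀ p ∈ C, IsCenter p)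
    {v : List (Move n)} (hv : EvenOn C v) : run v ∈ localGroup hC := by
  refine run_mem_localGroup_of_invariant hC hn hmid (P := fun _ => True) (fun _ _ => Iff.rfl) ?_ hv
  rintro ⟨⟨p, F⟩, hF⟩ ⟨⟨p', F'⟩, hF'⟩ hp (rfl : p = p') -
  exact Subtype.ext (Prod.ext rfl (face_eq_of_isCenter hn (hcen p hp) hF hF'))

theorem run_mem_localGroup_of_isWing {C : Finset (Pos n)} (hC : IsCluster C) (hn : 2 ≤ n)
    (hmid : ∀ p ∈ C, ¬ IsFaceMidpoint p) (hwing : ∀ p ∈ C, IsWing p)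
    {v : List (Move n)} (hv : EvenOn C v) : run v ∈ localGroup hC := by
  -- Chirality is invariant only on wings; the conjunct `IsWing` makes the property invariant on all
  -- facelets.
  refine run_mem_localGroup_of_invariant hC hn hmid
    (P := fun f => IsWing f.pos ∧ chirality f.pos f.face = true) (fun a f => ?_) ?_ hv
  · rw [rotFacelet_pos, rotFacelet_face, isWing_rot, and_congr_right_iff]
    intro h
    rw [chirality_rot a h f.2]
  · rintro ⟨⟨p, F⟩, hF⟩ ⟨⟨p', F'⟩, hF'⟩ hp (rfl : p = p') h
    refine Subtype.ext (Prod.ext rfl (face_eq_of_chirality_eq hn (hwing p hp) hF hF' ?_))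
    simpa [hwing p hp] using h

/-! ### Parity as the only obstruction modulo the local group -/

section Parity

variable {C : Finset (Pos n)} (hC : IsCluster C)

theorem mul_mem_localGroup_comm {g : Perm (Facelet n)} {v : List (Move n)}
    (h : g * run v ∈ localGroup hC) : run v * g ∈ localGroup hC := by
  have := conj_mem_localGroup hC h (undo v)
  rw [run_undo, inv_inv] at this
  simpa [mul_assoc] using this

theorem run_mem_localGroup_of_eq_id {w : List (Move n)}
    (h : ∀ f : Facelet n, f.pos ∈ C → run w f = f) : run w ∈ localGroup hC :=
  mem_localGroup_of_eq_on hC (one_mem _) h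

/-- If all moves act on the cluster either trivially, or oddly and like one and the same
involution modulo the local group, then even move sequences lie in the local group. -/
theorem run_mem_localGroup_of_moves {active : Fin n → Prop} {m₀ : Move n}
    (h₀ : m₀.positive = true) (hm₀ : active m₀.layer)
    (hinactive : ∀ a s, ¬ active s → ∀ f : Facelet n, f.pos ∈ C → turnFacelet a s f = f)
    (hactive : ∀ a s, active s → run [m₀, ⟨a, s, true⟩] ∈ localGroup hC)
    (hodd : ∀ a s, active s → sign (restrictPos hC [⟨a, s, true⟩]) = -1)
    {v : List (Move n)} (hv : EvenOn C v) : run v ∈ localGroup hC := by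
  -- The reference move is itself active, so it is an involution modulo the local group.
  have hsq : run [m₀, m₀] ∈ localGroup hC := by
    have := hactive m₀.axis m₀.layer hm₀
    rwa [← h₀] at this
  have hdiff (a : Fin 3) (s : Fin n) (hs : active s) :
      (run [m₀])⁻¹ * run [⟨a, s, true⟩] ∈ localGroup hC := by
    have h1 := mul_mem_localGroup_comm hC (g := run [⟨a, s, true⟩]) (v := [m₀])
      (by simpa [run] using hactive a s hs)
    have := mul_mem (inv_mem hsq) h1
    convert this using 1
    simp [run, mul_assoc]
  have hcases (m : Move n) :
      (run [m] ∈ localGroup hC ∧ sign (restrictPos hC [m]) = 1) ∨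
        (run [m₀, m] ∈ localGroup hC ∧ (run [m₀])⁻¹ * run [m] ∈ localGroup hC ∧
          sign (restrictPos hC [m]) = -1) := by
    obtain ⟨a, s, b⟩ := m
    have hinv : run [(⟨a, s, false⟩ : Move n)] = (run [⟨a, s, true⟩])⁻¹ :=
      run_undo [(⟨a, s, true⟩ : Move n)]
    have hinvPos : restrictPos hC [(⟨a, s, false⟩ : Move n)] =
        (restrictPos hC [⟨a, s, true⟩])⁻¹ := restrictPos_undo hC [(⟨a, s, true⟩ : Move n)]
    by_cases hs : active s
    · right
      cases b
      · rw [hinvPos, sign_inv]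
        refine ⟨?_, ?_, hodd a s hs⟩
        · have h2 := inv_mem (hdiff a s hs)
          rw [mul_inv_rev, inv_inv] at h2
          simpa [run, Move.onFacelet] using h2
        · rw [hinv, ← mul_inv_rev]
          simpa [run] using inv_mem (hactive a s hs)
      · exact ⟨hactive a s hs, hdiff a s hs, hodd a s hs⟩
    · left
      have hfix (f : Facelet n) (hf : f.pos ∈ C) : run [(⟨a, s, true⟩ : Move n)] f = f := by
        simpa [run, Move.onFacelet] using hinactive a s hs f hf
      have hmem := run_mem_localGroup_of_eq_id hC hfix
      have hone : restrictPos hC [(⟨a, s, true⟩ : Move n)] = 1 := by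
        refine Equiv.ext fun p => Subtype.ext ?_
        obtain ⟨f, hf⟩ := hC.exists_facelet p.2
        change runPos [(⟨a, s, true⟩ : Move n)] p = p
        rw [← hf, ← run_pos, hfix f (hf ▸ p.2)]
      cases b
      · rw [hinv, hinvPos, hone]
        exact ⟨inv_mem hmem, by simp⟩
      · rw [hone]
        exact ⟨hmem, by simp⟩
  -- Modulo the local group `run v` is trivial or the class of the reference move, and the sign on
  -- `C` tells which.
  have key (v : List (Move n)) :
      (run v ∈ localGroup hC ∧ sign (restrictPos hC v) = 1) ∨
        (run v * run [m₀] ∈ localGroup hC ∧ sign (restrictPos hC v) = -1) := by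
    induction v with
    | nil => exact Or.inl ⟨one_mem _, by rw [restrictPos_nil, Perm.sign_one]⟩
    | cons m w ih =>
      have e : run (m :: w) = run w * run [m] := run_append [m] w
      have e' : restrictPos hC (m :: w) = restrictPos hC w * restrictPos hC [m] :=
        restrictPos_append hC [m] w
      have e₀ : run [m₀, m] = run [m] * run [m₀] := run_append [m₀] [m]
      rw [e, e', Perm.sign_mul]
      rcases ih with ⟨h1, h2⟩ | ⟨h1, h2⟩ <;> rcases hcases m with ⟨h3, h4⟩ | ⟨h3, h5, h4⟩ <;>
        rw [h2, h4]
      · exact Or.inl ⟨mul_mem h1 h3, by decide⟩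
      · refine Or.inr ⟨?_, by decide⟩
        rw [mul_assoc, ← e₀]
        exact mul_mem h1 h3
      · refine Or.inr ⟨?_, by decide⟩
        convert mul_mem h1 (conj_mem_localGroup hC h3 [m₀]) using 1
        simp [mul_assoc]
      · refine Or.inl ⟨?_, by decide⟩
        convert mul_mem h1 h5 using 1
        simp [mul_assoc]
  obtain ⟨π, hπ, hsign⟩ := hv
  rw [Realizes.eq_restrictPos hC hπ] at hsign
  rcases key v with h | h
  · exact h.1
  · exact absurd (hsign.symm.trans h.2) (by decide)

end Parity

/-! ### Transfer from cubes of size 2 and 3 -/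

/-- The effect of a move on a position together with a face. -/
def Move.onSticker (m : Move n) (x : Pos n × Face) : Pos n × Face :=
  if x.1 m.axis = m.layer then
    if m.positive then (rotPos m.axis x.1, rotFace m.axis x.2)
    else ((rotPos m.axis).symm x.1, (rotFace m.axis).symm x.2)
  else x

/-- The effect of a sequence of moves on a position together with a face. -/
def runSticker (w : List (Move n)) (x : Pos n × Face) : Pos n × Face :=
  w.foldl (fun x m => m.onSticker x) x

theorem Move.onFacelet_val (m : Move n) (f : Facelet n) : (m.onFacelet f).1 = m.onSticker f.1 := by
  obtain ⟨a, s, b⟩ := m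
  cases b
  · change ((turnFacelet a s).symm f).1 = _
    by_cases h : f.1.1 a = s <;> simp [turnFacelet, h, Move.onSticker, rotFacelet]
  · change (turnFacelet a s f).1 = _
    by_cases h : f.1.1 a = s <;> simp [turnFacelet, h, Move.onSticker, rotFacelet]

/-- Replaces permutations of a subtype by a fold over plain pairs, which the kernel can evaluate in
the finite checks. -/
theorem run_val (w : List (Move n)) (f : Facelet n) : (run w f).1 = runSticker w f.1 := by
  induction w generalizing f with
  | nil => rfl
  | cons m w ih => rw [run, Perm.mul_apply, ih, Move.onFacelet_val]; rfl

/-- A symmetric embedding of the layers of the `m`-cube into those of the `n`-cube. -/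
structure LayerEmbedding (m n : ℕ) where
  toFun : Fin m → Fin n
  injective : Function.Injective toFun
  map_rev : ∀ s, toFun s.rev = (toFun s).rev
  map_zero_iff : ∀ s, (toFun s : ℕ) = 0 ↔ (s : ℕ) = 0

namespace LayerEmbedding

variable {m : ℕ} (ι : LayerEmbedding m n)

theorem map_last_iff (s : Fin m) : (ι.toFun s : ℕ) + 1 = n ↔ (s : ℕ) + 1 = m := by
  have h := ι.map_zero_iff s.rev
  rw [ι.map_rev, Fin.val_rev, Fin.val_rev] at h
  omega

/-- The position of the large cube that corresponds to a position of the small one. -/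
def pos (p : Pos m) : Pos n := fun b => ι.toFun (p b)

theorem pos_injective : Function.Injective ι.pos := fun _ _ h =>
  funext fun b => ι.injective (congrFun h b)

theorem onFace_pos (p : Pos m) (F : Face) : OnFace (ι.pos p) F ↔ OnFace p F := by
  obtain ⟨d, t⟩ := F
  cases t
  · exact ι.map_zero_iff _
  · exact ι.map_last_iff _

theorem rotPos_pos (a : Fin 3) (p : Pos m) : rotPos a (ι.pos p) = ι.pos (rotPos a p) := by
  funext b
  fin_cases a <;> fin_cases b <;> simp [rotPos, pos, ι.map_rev]

/-- The facelet of the large cube that corresponds to a facelet of the small one. -/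
def facelet (f : Facelet m) : Facelet n := ⟨(ι.pos f.pos, f.face), (ι.onFace_pos _ _).2 f.2⟩

theorem rotFacelet_facelet (a : Fin 3) (f : Facelet m) :
    rotFacelet a (ι.facelet f) = ι.facelet (rotFacelet a f) :=
  Subtype.ext (Prod.ext (ι.rotPos_pos a f.pos) rfl)

/-- The move of the large cube that corresponds to a move of the small one. -/
def move (k : Move m) : Move n := ⟨k.axis, ι.toFun k.layer, k.positive⟩

theorem turnFacelet_facelet (a : Fin 3) (s : Fin m) (f : Facelet m) :
    turnFacelet a (ι.toFun s) (ι.facelet f) = ι.facelet (turnFacelet a s f) := by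
  by_cases h : f.pos a = s
  · have h' : (ι.facelet f).pos a = ι.toFun s := congrArg ι.toFun h
    have e1 : turnFacelet a (ι.toFun s) (ι.facelet f) = rotFacelet a (ι.facelet f) := if_pos h'
    have e2 : turnFacelet a s f = rotFacelet a f := if_pos h
    rw [e1, e2, rotFacelet_facelet]
  · have h' : (ι.facelet f).pos a ≠ ι.toFun s := fun e => h (ι.injective e)
    rw [turnFacelet_of_ne h, turnFacelet_of_ne h']

theorem onFacelet_facelet (k : Move m) (f : Facelet m) :
    (ι.move k).onFacelet (ι.facelet f) = ι.facelet (k.onFacelet f) := by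
  obtain ⟨a, s, b⟩ := k
  cases b
  · change (turnFacelet a (ι.toFun s))⁻¹ _ = ι.facelet ((turnFacelet a s)⁻¹ f)
    rw [Perm.inv_eq_iff_eq, turnFacelet_facelet, ← Perm.mul_apply, mul_inv_cancel, Perm.one_apply]
  · exact ι.turnFacelet_facelet a s f

theorem run_facelet (w : List (Move m)) (f : Facelet m) :
    run (w.map ι.move) (ι.facelet f) = ι.facelet (run w f) := by
  induction w generalizing f with
  | nil => rfl
  | cons k w ih =>
    simp only [List.map_cons, run, Perm.mul_apply, onFacelet_facelet, ih]

theorem undo_map (w : List (Move m)) : (undo w).map ι.move = undo (w.map ι.move) := by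
  simp only [undo, List.map_reverse, List.map_map]
  rfl

end LayerEmbedding

/-- The product of the conjugates of `w` by the given sequences of moves. -/
def conjWord (w : List (Move n)) (us : List (List (Move n))) : List (Move n) :=
  (us.map fun u => u ++ w ++ undo u).flatten

theorem run_conjWord_mem_localGroup {C : Finset (Pos n)} (hC : IsCluster C) {m : ℕ}
    (ι : LayerEmbedding m n) {w : List (Move m)} (hw : run (w.map ι.move) ∈ localGroup hC)
    (us : List (List (Move m))) : run ((conjWord w us).map ι.move) ∈ localGroup hC := by
  induction us with
  | nil => exact one_mem _
  | cons u us ih =>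
    have e : conjWord w (u :: us) = u ++ w ++ undo u ++ conjWord w us := by simp [conjWord]
    rw [e, List.map_append, run_append]
    refine mul_mem ih ?_
    have := conj_mem_localGroup hC hw (u.map ι.move)
    rwa [List.map_append, List.map_append, ι.undo_map, run_append, run_append, run_undo,
      ← mul_assoc]

instance (p : Pos n) (F : Face) : Decidable (OnFace p F) :=
  inferInstanceAs (Decidable (if F.2 then (p F.1 : ℕ) + 1 = n else (p F.1 : ℕ) = 0))

/-- The data about a class of positions of a small cube from which the even move sequences of the
corresponding cluster of a large cube are shown to lie in its cluster group. -/
structure Model (m : ℕ) where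
  IsMember : Pos m → Prop
  isActive : Fin m → Prop
  base : List (Move m)
  reference : Move m
  member_rot : ∀ a p, IsMember (rotPos a p) ↔ IsMember p
  transitive : ∀ p q, IsMember p → IsMember q →
    ∃ i j k : Fin 4, ((rotPos 0)^[i] ((rotPos 1)^[j] ((rotPos 2)^[k] p))) = q
  reference_positive : reference.positive = true
  reference_active : isActive reference.layer
  inactive : ∀ a s, ¬ isActive s → ∀ p F, IsMember p → OnFace p F →
    runSticker [⟨a, s, true⟩] (p, F) = (p, F)
  -- On the stickers of the class, the reference turn followed by an active turn is a product of
  -- conjugates of `base`.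
  certificate : ∀ a s, isActive s → ∃ us, ∀ p F, IsMember p → OnFace p F →
    runSticker (conjWord base us) (p, F) = runSticker [reference, ⟨a, s, true⟩] (p, F)
  -- The members in an active slice form a single orbit of length four, so the turn is odd on them.
  four_cycle : ∀ a s, isActive s → ∃ p, IsMember p ∧ p a = s ∧ rotPos a (rotPos a p) ≠ p ∧
    ∀ q, IsMember q → q a = s → q = p ∨ q = rotPos a p ∨ q = rotPos a (rotPos a p) ∨
      q = rotPos a (rotPos a (rotPos a p))

theorem rotPos_four (a : Fin 3) (p : Pos n) : rotPos a (rotPos a (rotPos a (rotPos a p))) = p := by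
  funext b
  fin_cases a <;> fin_cases b <;> simp [rotPos]

namespace Model

variable {m : ℕ} (M : Model m) (ι : LayerEmbedding m n) {C : Finset (Pos n)} (hC : IsCluster C)
include hC

/-- Invariance of the class under rotations keeps the cluster inside its image. Conversely,
whole-cube rotations are transitive on the class, and on a single cubie a rotation is a slice turn.
-/
theorem mem_iff {p₀ : Pos m} (h₀ : M.IsMember p₀) (hp₀ : ι.pos p₀ ∈ C) (q : Pos n) :
    q ∈ C ↔ ∃ p, M.IsMember p ∧ ι.pos p = q := by
  constructor
  · intro hq
    obtain ⟨w, rfl⟩ := hC.exists_runPos hp₀ hq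
    refine (runPos_induction (P := fun q => ∃ p, M.IsMember p ∧ ι.pos p = q) (fun a q => ?_)
      w _).2 ⟨p₀, h₀, rfl⟩
    constructor
    · rintro ⟨p, hp, h⟩
      refine ⟨(rotPos a).symm p, ?_, ?_⟩
      · rw [← M.member_rot a]
        simpa using hp
      · apply (rotPos a).injective
        rw [ι.rotPos_pos, ← h, Equiv.apply_symm_apply]
    · rintro ⟨p, hp, rfl⟩
      exact ⟨rotPos a p, (M.member_rot a p).2 hp, (ι.rotPos_pos a p).symm⟩
  · rintro ⟨p, hp, rfl⟩
    obtain ⟨i, j, k, rfl⟩ := M.transitive p₀ p h₀ hp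
    have hit (a : Fin 3) (i : ℕ) (p : Pos m) (hp : ι.pos p ∈ C) :
        ι.pos ((rotPos a)^[i] p) ∈ C := by
      induction i with
      | zero => exact hp
      | succ i ih =>
        rw [Function.iterate_succ_apply', ← ι.rotPos_pos]
        exact hC.rotPos_mem ih a
    exact hit _ _ _ (hit _ _ _ (hit _ _ _ hp₀))

/-- The active layers of the large cube are the images of the active ones; all other layers either
miss the cluster or turn it trivially. -/
theorem run_mem_localGroup {p₀ : Pos m} (h₀ : M.IsMember p₀) (hp₀ : ι.pos p₀ ∈ C)
    (hbase : run (M.base.map ι.move) ∈ localGroup hC) {v : List (Move n)} (hv : EvenOn C v) :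
    run v ∈ localGroup hC := by
  have hmem := M.mem_iff ι hC h₀ hp₀
  have hfac (f : Facelet n) (hf : f.pos ∈ C) : ∃ g : Facelet m, M.IsMember g.pos ∧
      ι.facelet g = f := by
    obtain ⟨p, hp, h⟩ := (hmem _).1 hf
    have hF : OnFace p f.face := by
      rw [← ι.onFace_pos, h]
      exact f.2
    exact ⟨⟨(p, f.face), hF⟩, hp, Subtype.ext (Prod.ext h rfl)⟩
  refine run_mem_localGroup_of_moves hC (active := fun s => ∃ k, M.isActive k ∧ ι.toFun k = s)
    (m₀ := ι.move M.reference) M.reference_positive ⟨_, M.reference_active, rfl⟩ ?_ ?_ ?_ hv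
  · intro a s hs f hf
    obtain ⟨g, hg, rfl⟩ := hfac f hf
    by_cases hk : ∃ k, ι.toFun k = s
    · obtain ⟨k, rfl⟩ := hk
      have := M.inactive a k (fun h => hs ⟨k, h, rfl⟩) g.pos g.face hg g.2
      rw [ι.turnFacelet_facelet]
      congr 1
      apply Subtype.ext
      exact (run_val [⟨a, k, true⟩] g).trans this
    · exact turnFacelet_of_ne fun h => hk ⟨_, h⟩
  · rintro a _ ⟨s, hs, rfl⟩
    obtain ⟨us, hus⟩ := M.certificate a s hs
    refine mem_localGroup_of_eq_on hC (run_conjWord_mem_localGroup hC ι hbase us) fun f hf => ?_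
    obtain ⟨g, hg, rfl⟩ := hfac f hf
    rw [ι.run_facelet]
    refine (ι.run_facelet [M.reference, ⟨a, s, true⟩] g).trans ?_
    congr 1
    apply Subtype.ext
    rw [run_val, run_val]
    exact (hus g.pos g.face hg g.2).symm
  · rintro a _ ⟨s, hs, rfl⟩
    obtain ⟨p, hp, hps, h2, hall⟩ := M.four_cycle a s hs
    have hval (x : C) : ((restrictPos hC [⟨a, ι.toFun s, true⟩] x : C) : Pos n) =
        turnPos a (ι.toFun s) x := by
      simp [restrictPos, runPos, Move.onPos]
    have hstep (q : Pos m) (hq : M.IsMember q) (hqs : q a = s) :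
        restrictPos hC [⟨a, ι.toFun s, true⟩] ⟨ι.pos q, (hmem _).2 ⟨q, hq, rfl⟩⟩ =
          ⟨ι.pos (rotPos a q), (hmem _).2 ⟨_, (M.member_rot a q).2 hq, rfl⟩⟩ := by
      apply Subtype.ext
      rw [hval]
      dsimp only
      rw [turnPos_of_eq (congrArg ι.toFun hqs), ι.rotPos_pos]
    have hp1 := (M.member_rot a p).2 hp
    have hp2 := (M.member_rot a _).2 hp1
    have hp3 := (M.member_rot a _).2 hp2
    have hs1 : rotPos a p a = s := (rotPos_axis a p).trans hps
    have hs2 : rotPos a (rotPos a p) a = s := (rotPos_axis a _).trans hs1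
    have hs3 : rotPos a (rotPos a (rotPos a p)) a = s := (rotPos_axis a _).trans hs2
    refine sign_eq_neg_one_of_four_cycle (x := ⟨ι.pos p, (hmem _).2 ⟨p, hp, rfl⟩⟩) ?_ ?_ ?_
    · rw [hstep p hp hps, hstep _ hp1 hs1]
      intro h
      exact h2 (ι.pos_injective (congrArg Subtype.val h))
    · simp only [hstep p hp hps, hstep _ hp1 hs1, hstep _ hp2 hs2, hstep _ hp3 hs3, rotPos_four]
    · rintro ⟨y, hy⟩ hne
      simp only [hstep p hp hps, hstep _ hp1 hs1, hstep _ hp2 hs2]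
      obtain ⟨q, hq, rfl⟩ := (hmem y).1 hy
      have hqs : q a = s := by
        by_contra h
        apply hne
        apply Subtype.ext
        rw [hval]
        exact turnPos_of_ne fun e => h (ι.injective e)
      rcases hall q hq hqs with rfl | rfl | rfl | rfl
      · exact Or.inl rfl
      · exact Or.inr (Or.inl rfl)
      · exact Or.inr (Or.inr (Or.inl rfl))
      · exact Or.inr (Or.inr (Or.inr rfl))

end Model

/-! ### Certificates for corners, middle edges and face midpoints -/

/-- Sequences conjugating the 3-cycle of corners to factors of a product of two turns. -/
def cornerCertificate : Fin 3 → Fin 2 → List (List (Move 2))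
  | 0, 0 =>
    [[⟨0, 1, false⟩, ⟨0, 0, true⟩],
      [⟨1, 1, false⟩, ⟨0, 0, false⟩],
      [⟨2, 1, true⟩, ⟨1, 0, true⟩, ⟨0, 1, false⟩]]
  | 0, 1 =>
    [[⟨1, 1, true⟩, ⟨0, 0, true⟩, ⟨2, 1, true⟩],
      [⟨2, 1, false⟩],
      [⟨2, 0, true⟩, ⟨0, 0, true⟩, ⟨1, 0, false⟩]]
  | 1, 0 =>
    [[⟨0, 1, false⟩],
      [⟨2, 1, true⟩, ⟨0, 1, false⟩, ⟨1, 0, false⟩],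
      [⟨1, 0, true⟩, ⟨2, 1, false⟩, ⟨2, 0, true⟩]]
  | 1, 1 =>
    [[⟨1, 1, false⟩],
      [⟨1, 0, false⟩, ⟨2, 1, false⟩, ⟨0, 0, true⟩],
      [⟨1, 1, true⟩, ⟨1, 0, false⟩, ⟨2, 1, true⟩, ⟨1, 0, true⟩]]
  | 2, 0 =>
    [[⟨0, 1, false⟩, ⟨0, 0, true⟩],
      [⟨1, 0, true⟩, ⟨0, 0, false⟩],
      [⟨0, 0, true⟩, ⟨2, 0, false⟩],
      [⟨0, 1, false⟩, ⟨1, 1, true⟩, ⟨2, 1, false⟩, ⟨0, 0, true⟩]]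
  | 2, 1 =>
    [[⟨0, 0, true⟩, ⟨1, 1, true⟩, ⟨0, 0, false⟩],
      [⟨1, 0, true⟩, ⟨2, 0, true⟩, ⟨1, 0, false⟩]]

/-- Sequences conjugating the 3-cycle of middle edges to factors of a product of two turns. -/
def edgeCertificate : Fin 3 → Fin 3 → List (List (Move 3))
  | 0, 0 =>
    [[⟨1, 0, true⟩, ⟨2, 0, true⟩, ⟨1, 2, false⟩],
      [⟨0, 1, true⟩, ⟨2, 2, true⟩],
      [⟨2, 2, false⟩, ⟨1, 1, true⟩, ⟨2, 0, false⟩]]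
  | 0, 1 =>
    [[⟨2, 2, false⟩, ⟨0, 0, false⟩],
      [⟨2, 2, true⟩, ⟨0, 0, false⟩],
      [⟨0, 1, true⟩, ⟨1, 2, false⟩]]
  | 0, 2 =>
    [[⟨1, 2, false⟩, ⟨0, 0, false⟩, ⟨2, 0, true⟩],
      [⟨1, 0, false⟩, ⟨2, 0, false⟩, ⟨1, 2, false⟩],
      [⟨0, 2, false⟩, ⟨2, 1, true⟩, ⟨0, 1, true⟩, ⟨2, 0, false⟩]]
  | 1, 0 =>
    [[⟨2, 1, false⟩, ⟨1, 1, true⟩, ⟨2, 0, false⟩],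
      [⟨2, 1, false⟩, ⟨1, 2, false⟩, ⟨0, 1, false⟩],
      [⟨2, 0, false⟩, ⟨0, 0, false⟩, ⟨1, 0, false⟩]]
  | 1, 1 =>
    [[⟨2, 0, false⟩, ⟨1, 2, false⟩],
      [⟨2, 0, true⟩, ⟨0, 0, false⟩],
      [⟨2, 2, true⟩, ⟨2, 2, true⟩, ⟨2, 0, true⟩, ⟨0, 0, false⟩]]
  | 1, 2 =>
    [[⟨2, 1, true⟩, ⟨1, 1, true⟩, ⟨2, 0, false⟩],
      [⟨0, 1, false⟩, ⟨1, 2, false⟩, ⟨0, 1, false⟩],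
      [⟨1, 2, false⟩, ⟨0, 0, false⟩, ⟨2, 0, true⟩]]
  | 2, 0 =>
    [[⟨2, 2, false⟩, ⟨0, 0, false⟩],
      [⟨1, 2, true⟩, ⟨2, 0, false⟩],
      [⟨2, 0, true⟩, ⟨0, 0, false⟩],
      [⟨2, 2, true⟩, ⟨0, 0, false⟩]]
  | 2, 1 =>
    [[⟨1, 0, true⟩],
      [⟨1, 1, true⟩, ⟨2, 0, false⟩],
      [⟨0, 2, false⟩, ⟨2, 0, false⟩],
      [⟨1, 2, false⟩, ⟨0, 0, false⟩, ⟨2, 0, true⟩]]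
  | 2, 2 =>
    [[⟨1, 2, false⟩, ⟨0, 0, false⟩, ⟨2, 0, true⟩],
      [⟨0, 0, false⟩, ⟨1, 1, true⟩, ⟨2, 0, false⟩]]

/-- Sequences conjugating the commutator of two middle slices to factors of a product of two of
their turns. -/
def midpointCertificate : Fin 3 → Fin 3 → List (List (Move 3))
  | 0, 1 =>
    [[⟨1, 1, false⟩, ⟨0, 1, true⟩, ⟨0, 1, true⟩]]
  | 1, 1 =>
    [[⟨1, 1, false⟩, ⟨0, 1, false⟩]]
  | 2, 1 =>
    [[],
      [⟨0, 1, true⟩]]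
  | _, _ => []

/-- The corners, as the positions of the cube of size 2. -/
def cornerModel : Model 2 where
  IsMember _ := True
  isActive _ := True
  base := threeCycleWord 0 1 1
  reference := ⟨2, 1, true⟩
  member_rot _ _ := Iff.rfl
  transitive := by decide +kernel
  reference_positive := rfl
  reference_active := trivial
  inactive _ _ h := absurd trivial h
  -- The check covers all 24 corner stickers, so twists need no separate argument.
  certificate a s _ := ⟨cornerCertificate a s, by revert a s; decide +kernel⟩
  four_cycle := by decide +kernel

/-- The number of coordinates of a position of the cube of size 3 that are in the middle. -/
def middleCount (p : Pos 3) : ℕ :=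
  (if p 0 = 1 then 1 else 0) + (if p 1 = 1 then 1 else 0) + (if p 2 = 1 then 1 else 0)

/-- The edges of the cube of size 3. -/
def edgeModel : Model 3 where
  IsMember p := middleCount p = 1
  isActive _ := True
  base := threeCycleWord 1 0 2
  reference := ⟨2, 2, true⟩
  member_rot := by decide +kernel
  transitive := by decide +kernel
  reference_positive := rfl
  reference_active := trivial
  inactive _ _ h := absurd trivial h
  certificate a s _ := ⟨edgeCertificate a s, by revert a s; decide +kernel⟩
  four_cycle := by decide +kernel

/-- The face midpoints of the cube of size 3. -/
def midpointModel : Model 3 where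
  IsMember p := middleCount p = 2
  isActive s := s = 1
  -- A midpoint of the top face has `a = c`, which rules out the 3-cycle word. Two middle slices
  -- meet in a line whose only visible cubies are face midpoints, so their plain commutator is
  -- local.
  base := [⟨0, 1, false⟩, ⟨1, 1, false⟩, ⟨0, 1, true⟩, ⟨1, 1, true⟩]
  reference := ⟨2, 1, true⟩
  member_rot := by decide +kernel
  transitive := by decide +kernel
  reference_positive := rfl
  reference_active := rfl
  inactive := by decide +kernel
  certificate a s hs := ⟨midpointCertificate a s, by revert a s; decide +kernel⟩
  four_cycle := by decide +kernel

/-! ### Embeddings of the small cubes and classification of clusters -/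

/-- The embedding of the cube of size 2 by its two outer layers in each direction. -/
def cornerEmbedding (hn : 2 ≤ n) : LayerEmbedding 2 n where
  toFun s := ⟨s * (n - 1), by have := s.isLt; interval_cases (s : ℕ) <;> omega⟩
  injective s t h := by
    have h := Nat.eq_of_mul_eq_mul_right (by omega) (Fin.mk.inj h)
    exact Fin.ext h
  map_rev s := by
    apply Fin.ext
    fin_cases s <;> simp [Fin.val_rev]; omega
  map_zero_iff s := by
    fin_cases s <;> simp; omega

/-- The embedding of the cube of size 3 by the outer layers and the middle layer of a cube of odd
size. -/
def middleEmbedding (hn : 2 ≤ n) (hodd : n % 2 = 1) : LayerEmbedding 3 n where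
  toFun s := ⟨s * ((n - 1) / 2), by have := s.isLt; interval_cases (s : ℕ) <;> omega⟩
  injective s t h := by
    have h := Nat.eq_of_mul_eq_mul_right (by omega) (Fin.mk.inj h)
    exact Fin.ext h
  map_rev s := by
    apply Fin.ext
    fin_cases s <;> simp [Fin.val_rev] <;> omega
  map_zero_iff s := by
    fin_cases s <;> simp <;> omega

theorem exists_cornerEmbedding (hn : 2 ≤ n) {x : Fin n} (hx : extremal x = true) :
    ∃ s, (cornerEmbedding hn).toFun s = x := by
  simp only [extremal, decide_eq_true_eq] at hx
  rcases hx with hx | hx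
  · exact ⟨0, Fin.ext (by simp [cornerEmbedding, hx])⟩
  · exact ⟨1, Fin.ext (by simp [cornerEmbedding]; omega)⟩

theorem exists_middleEmbedding_of_extremal (hn : 2 ≤ n) (hodd : n % 2 = 1) {x : Fin n}
    (hx : extremal x = true) : ∃ s, s ≠ 1 ∧ (middleEmbedding hn hodd).toFun s = x := by
  simp only [extremal, decide_eq_true_eq] at hx
  rcases hx with hx | hx
  · exact ⟨0, by decide, Fin.ext (by simp [middleEmbedding, hx])⟩
  · exact ⟨2, by decide, Fin.ext (by simp [middleEmbedding]; omega)⟩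

theorem middleEmbedding_one (hn : 2 ≤ n) (hodd : n % 2 = 1) {x : Fin n}
    (hx : middle x = true) : (middleEmbedding hn hodd).toFun 1 = x := by
  simp only [middle, decide_eq_true_eq] at hx
  exact Fin.ext (by simp [middleEmbedding]; omega)

theorem odd_of_middle {x : Fin n} (hx : middle x = true) : n % 2 = 1 := by
  simp only [middle, decide_eq_true_eq] at hx
  omega

theorem middle_eq_false_of_extremal (hn : 2 ≤ n) {x : Fin n} (hx : extremal x = true) :
    middle x = false := by
  simp only [extremal, decide_eq_true_eq] at hx
  simp only [middle, decide_eq_false_iff_not]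
  omega

theorem LayerEmbedding.pos_vec {m : ℕ} (ι : LayerEmbedding m n) (x y z : Fin m) :
    ι.pos ![x, y, z] = ![ι.toFun x, ι.toFun y, ι.toFun z] := by
  funext b; fin_cases b <;> rfl

theorem pos_eq_vec (p : Pos n) : p = ![p 0, p 1, p 2] := by
  funext b; fin_cases b <;> rfl

theorem isFaceMidpoint_iff (hn : 2 ≤ n) (p : Pos n) : IsFaceMidpoint p ↔
    (extremal (p 0) = true ∧ middle (p 1) = true ∧ middle (p 2) = true) ∨
      (middle (p 0) = true ∧ extremal (p 1) = true ∧ middle (p 2) = true) ∨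
      (middle (p 0) = true ∧ middle (p 1) = true ∧ extremal (p 2) = true) := by
  constructor
  · rintro ⟨F, hF, h⟩
    have he := onFace_extremal hF
    obtain ⟨d, t⟩ := F
    have h0 := h 0
    have h1 := h 1
    have h2 := h 2
    fin_cases d <;> simp [middle] at * <;> tauto
  · have key (d : Fin 3) (he : extremal (p d) = true) (hm : ∀ b, b ≠ d → middle (p b) = true) :
        IsFaceMidpoint p := by
      have hd := middle_eq_false_of_extremal hn he
      simp only [extremal, decide_eq_true_eq] at he
      simp only [middle, decide_eq_true_eq, decide_eq_false_iff_not] at hm hd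
      rcases he with he | he
      · exact ⟨(d, false), by simpa [OnFace] using he,
          fun b => ⟨fun h e => hd (by rw [e] at h; exact h), hm b⟩⟩
      · exact ⟨(d, true), by simpa [OnFace] using he,
          fun b => ⟨fun h e => hd (by rw [e] at h; exact h), hm b⟩⟩
    rintro (⟨h0, h1, h2⟩ | ⟨h0, h1, h2⟩ | ⟨h0, h1, h2⟩)
    · exact key 0 h0 fun b hb => by fin_cases b <;> simp_all
    · exact key 1 h1 fun b hb => by fin_cases b <;> simp_all
    · exact key 2 h2 fun b hb => by fin_cases b <;> simp_all

theorem isFaceMidpoint_rot (hn : 2 ≤ n) (a : Fin 3) (p : Pos n) :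
    IsFaceMidpoint (rotPos a p) ↔ IsFaceMidpoint p := by
  rw [isFaceMidpoint_iff hn, isFaceMidpoint_iff hn]
  fin_cases a <;> simp [rotPos, extremal_rev, middle_rev] <;> tauto

section

variable {C : Finset (Pos n)} (hC : IsCluster C)
include hC

/-- A rotation-invariant property of one cubie of a cluster holds for all its cubies. -/
theorem IsCluster.forall_mem {P : Pos n → Prop} (hP : ∀ a p, P (rotPos a p) ↔ P p) {p : Pos n}
    (hp : p ∈ C) (h : P p) : ∀ q ∈ C, P q := by
  intro q hq
  obtain ⟨w, rfl⟩ := hC.exists_runPos hp hq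
  exact (runPos_induction hP w p).2 h

/-- The embedded base word is again a 3-cycle word, so its locality in the large cube follows from
the commutator argument; the finite check concerns only the cluster itself. -/
theorem run_mem_localGroup_of_threeCycleModel {m : ℕ} {M : Model m} (ι : LayerEmbedding m n)
    {a c top : Fin m} (hM : M.base = threeCycleWord a c top) (hac : a ≠ c)
    (hq : M.IsMember ![a, c, top]) {p : Pos m} (hp : M.IsMember p) (hpC : ι.pos p ∈ C)
    {v : List (Move n)} (hv : EvenOn C v) : run v ∈ localGroup hC := by
  refine M.run_mem_localGroup ι hC hp hpC ?_ hv
  have hmap : (threeCycleWord a c top).map ι.move =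
      threeCycleWord (ι.toFun a) (ι.toFun c) (ι.toFun top) := rfl
  rw [hM, hmap]
  refine run_mem_localGroup hC (by simp [threeCycleWord])
    (affectsOnly_threeCycleWord hC (fun h => hac (ι.injective h)) ?_)
  rw [← ι.pos_vec]
  exact (M.mem_iff ι hC hp hpC _).2 ⟨_, hq, rfl⟩

theorem run_mem_localGroup_of_corner (hn : 2 ≤ n) {p : Pos n} (hp : p ∈ C)
    (he : ∀ b, extremal (p b) = true) {v : List (Move n)} (hv : EvenOn C v) :
    run v ∈ localGroup hC := by
  choose q hq using fun b => exists_cornerEmbedding hn (he b)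
  have hqp : (cornerEmbedding hn).pos q = p := funext hq
  exact run_mem_localGroup_of_threeCycleModel hC (M := cornerModel) (cornerEmbedding hn)
    (a := 0) (c := 1) (top := 1) rfl (by decide) trivial (p := q) trivial (by rwa [hqp]) hv

theorem run_mem_localGroup_of_middleEdge (hn : 2 ≤ n) {p : Pos n} (hp : p ∈ C)
    (h : (middle (p 0) = true ∧ extremal (p 1) = true ∧ extremal (p 2) = true) ∨
      (extremal (p 0) = true ∧ middle (p 1) = true ∧ extremal (p 2) = true) ∨
      (extremal (p 0) = true ∧ extremal (p 1) = true ∧ middle (p 2) = true))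
    {v : List (Move n)} (hv : EvenOn C v) : run v ∈ localGroup hC := by
  have hodd : n % 2 = 1 := by
    rcases h with h | h | h
    · exact odd_of_middle h.1
    · exact odd_of_middle h.2.1
    · exact odd_of_middle h.2.2
  obtain ⟨q, hq, hqp⟩ : ∃ q, edgeModel.IsMember q ∧ (middleEmbedding hn hodd).pos q = p := by
    rw [pos_eq_vec p]
    have ext {x : Fin n} := exists_middleEmbedding_of_extremal hn hodd (x := x)
    have mid {x : Fin n} := middleEmbedding_one hn hodd (x := x)
    rcases h with ⟨h0, h1, h2⟩ | ⟨h0, h1, h2⟩ | ⟨h0, h1, h2⟩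
    · obtain ⟨y, hy, e1⟩ := ext h1
      obtain ⟨z, hz, e2⟩ := ext h2
      exact ⟨![1, y, z], by simp [edgeModel, middleCount, hy, hz],
        by rw [LayerEmbedding.pos_vec, mid h0, e1, e2]⟩
    · obtain ⟨y, hy, e1⟩ := ext h0
      obtain ⟨z, hz, e2⟩ := ext h2
      exact ⟨![y, 1, z], by simp [edgeModel, middleCount, hy, hz],
        by rw [LayerEmbedding.pos_vec, mid h1, e1, e2]⟩
    · obtain ⟨y, hy, e1⟩ := ext h0
      obtain ⟨z, hz, e2⟩ := ext h1
      exact ⟨![y, z, 1], by simp [edgeModel, middleCount, hy, hz],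
        by rw [LayerEmbedding.pos_vec, mid h2, e1, e2]⟩
  exact run_mem_localGroup_of_threeCycleModel hC (M := edgeModel) (middleEmbedding hn hodd)
    (a := 1) (c := 0) (top := 2) rfl (by decide) (by simp [edgeModel, middleCount]) hq
    (by rwa [hqp]) hv

theorem run_mem_localGroup_of_isFaceMidpoint (hn : 2 ≤ n) {p : Pos n} (hp : p ∈ C)
    (h : IsFaceMidpoint p) {v : List (Move n)} (hv : EvenOn C v) : run v ∈ localGroup hC := by
  rw [isFaceMidpoint_iff hn] at h
  have hodd : n % 2 = 1 := by
    rcases h with h | h | h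
    · exact odd_of_middle h.2.1
    · exact odd_of_middle h.1
    · exact odd_of_middle h.1
  have ext {x : Fin n} := exists_middleEmbedding_of_extremal hn hodd (x := x)
  have mid {x : Fin n} := middleEmbedding_one hn hodd (x := x)
  obtain ⟨q, hq, hqp⟩ : ∃ q, midpointModel.IsMember q ∧ (middleEmbedding hn hodd).pos q = p := by
    rw [pos_eq_vec p]
    rcases h with ⟨h0, h1, h2⟩ | ⟨h0, h1, h2⟩ | ⟨h0, h1, h2⟩
    · obtain ⟨y, hy, e1⟩ := ext h0
      exact ⟨![y, 1, 1], by simp [midpointModel, middleCount, hy],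
        by rw [LayerEmbedding.pos_vec, e1, ← mid h1, ← mid h2]⟩
    · obtain ⟨y, hy, e1⟩ := ext h1
      exact ⟨![1, y, 1], by simp [midpointModel, middleCount, hy],
        by rw [LayerEmbedding.pos_vec, e1, ← mid h0, ← mid h2]⟩
    · obtain ⟨y, hy, e1⟩ := ext h2
      exact ⟨![1, 1, y], by simp [midpointModel, middleCount, hy],
        by rw [LayerEmbedding.pos_vec, e1, ← mid h0, ← mid h1]⟩
  have hqC : (middleEmbedding hn hodd).pos q ∈ C := by rwa [hqp]
  have hmem := midpointModel.mem_iff (middleEmbedding hn hodd) hC hq hqC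
  refine midpointModel.run_mem_localGroup (middleEmbedding hn hodd) hC hq hqC ?_ hv
  set ι := middleEmbedding hn hodd with hι
  refine run_mem_localGroup hC (by simp [midpointModel]) fun f hf => ?_
  have hrun : run (midpointModel.base.map ι.move) = turnFacelet 1 (ι.toFun 1) *
      turnFacelet 0 (ι.toFun 1) * (turnFacelet 1 (ι.toFun 1))⁻¹ *
        (turnFacelet 0 (ι.toFun 1))⁻¹ := by
    simp [midpointModel, LayerEmbedding.move, run, Move.onFacelet, mul_assoc]
  have hinv (a : Fin 3) (s : Fin n) : ((turnFacelet a s)⁻¹ f).pos ∉ C := by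
    have := hC.run_mem_iff [⟨a, s, false⟩] f
    simp only [run, Move.onFacelet] at this
    exact fun h => hf (this.1 h)
  rw [hrun]
  refine commutator_apply_eq_self (P := fun f => f.pos ∈ C) (fun g h1 h2 => ?_) hf
    (hinv _ _) (hinv _ _)
  have g1 : g.pos 1 = ι.toFun 1 := by
    by_contra h
    exact h1 (turnFacelet_of_ne h)
  have g0 : g.pos 0 = ι.toFun 1 := by
    by_contra h
    exact h2 (turnFacelet_of_ne h)
  have hmid : extremal (ι.toFun 1) = false := by
    simp [extremal, hι, middleEmbedding]
    omega
  have hface := onFace_extremal g.2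
  -- Two coordinates lie in the middle slice, which is not extremal, so the visible side is on the
  -- third axis.
  have g2 : extremal (g.pos 2) = true := by
    obtain ⟨⟨r, d, t⟩, hr⟩ := g
    fin_cases d
    · simp [Facelet.pos] at hface g0
      rw [g0, hmid] at hface
      exact absurd hface (by decide)
    · simp [Facelet.pos] at hface g1
      rw [g1, hmid] at hface
      exact absurd hface (by decide)
    · exact hface
  obtain ⟨z, hz, e⟩ := ext g2
  refine (hmem _).2 ⟨![1, 1, z], by simp [midpointModel, middleCount, hz], ?_⟩
  rw [LayerEmbedding.pos_vec, pos_eq_vec g.pos, g0, g1, e]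

/-- A move sequence that permutes the cubies of a cluster evenly acts on the cluster like an element
of its cluster group. -/
theorem run_mem_localGroup_of_evenOn {v : List (Move n)} (hv : EvenOn C v) :
    run v ∈ localGroup hC := by
  obtain ⟨p, hp⟩ := hC.nonempty
  have hn0 := (p 0).isLt
  by_cases hn : 2 ≤ n
  · by_cases hmid : IsFaceMidpoint p
    · exact run_mem_localGroup_of_isFaceMidpoint hC hn hp hmid hv
    have hmid' : ∀ q ∈ C, ¬ IsFaceMidpoint q :=
      hC.forall_mem (fun a p => not_congr (isFaceMidpoint_rot hn a p)) hp hmid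
    rw [isFaceMidpoint_iff hn] at hmid
    by_cases hcor : ∀ b, extremal (p b) = true
    · exact run_mem_localGroup_of_corner hC hn hp hcor hv
    by_cases hcen : IsCenter p
    · exact run_mem_localGroup_of_isCenter hC hn hmid' (hC.forall_mem isCenter_rot hp hcen) hv
    by_cases hwing : IsWing p
    · exact run_mem_localGroup_of_isWing hC hn hmid' (hC.forall_mem isWing_rot hp hwing) hv
    -- In the remaining case exactly two coordinates are extremal, and the third is in the middle
    -- because the cubie is not a wing.
    refine run_mem_localGroup_of_middleEdge hC hn hp ?_ hv
    obtain ⟨F, hF⟩ := hC.visible hp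
    have hext := onFace_extremal hF
    have k0 := middle_eq_false_of_extremal hn (x := p 0)
    have k1 := middle_eq_false_of_extremal hn (x := p 1)
    have k2 := middle_eq_false_of_extremal hn (x := p 2)
    have hext' : extremal (p 0) = true ∨ extremal (p 1) = true ∨ extremal (p 2) = true := by
      obtain ⟨d, t⟩ := F
      fin_cases d
      · exact Or.inl hext
      · exact Or.inr (Or.inl hext)
      · exact Or.inr (Or.inr hext)
    have hcor' : ¬ (extremal (p 0) = true ∧ extremal (p 1) = true ∧ extremal (p 2) = true) :=
      fun ⟨h0, h1, h2⟩ => hcor fun b => by fin_cases b <;> assumption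
    simp only [IsCenter, IsWing] at hcen hwing
    clear hext hcor
    cases h0 : extremal (p 0) <;> cases h1 : extremal (p 1) <;> cases h2 : extremal (p 2) <;>
      simp_all
  -- For `n = 1` the cluster is the whole cube, so every single move is local and parity plays no
  -- role.
  · have hall (f : Facelet n) : f.pos ∈ C := by
      convert hp using 1
      funext b
      exact Fin.ext (by have := (f.pos b).isLt; have := (p b).isLt; omega)
    clear hv
    induction v with
    | nil => exact one_mem _
    | cons m v ih =>
      have e : run (m :: v) = run v * run [m] := run_append [m] v
      rw [e]
      exact mul_mem ih (run_mem_localGroup hC (by simp) fun f hf => absurd (hall f) hf)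

/-- Even permutations of a cluster other than that of the face midpoints come from its cluster
group. -/
theorem exists_restrictPos_eq_of_sign (hmid : ∀ p ∈ C, ¬ IsFaceMidpoint p) {π : Perm C}
    (hπ : sign π = 1) : ∃ w, run w ∈ localGroup hC ∧ restrictPos hC w = π := by
  by_cases hn : 2 ≤ n
  · obtain ⟨a, c, top, htop, hac, hat, hq⟩ := hC.exists_mem_top_face hn hmid
    exact alternatingGroup_le_localPerms hC htop hac hat hq (mem_alternatingGroup.2 hπ)
  · refine ⟨[], one_mem _, Equiv.ext fun p => Subtype.ext (funext fun b => Fin.ext ?_)⟩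
    have h1 := ((restrictPos hC [] p : Pos n) b).isLt
    have h2 := ((π p : Pos n) b).isLt
    omega

end

end RubiksCube

open RubiksCube in
/-- There is an absolute constant `K` such that for every cluster `C` of the `n × n × n` cube:
* if a colouring `c` shows on `C` the arrangement produced from the solved cube by some sequence
  `v` whose permutation of the cubies of `C` is even, then at most `K` moves solve `C`
  (in colours, and bringing each single sticker of `C` home) and leave all else unaffected;
* unless `C` consists of the six middle cubies of the faces, every even permutation of
  the cubies of `C` is performed by at most `K` moves that leave all else unaffected. -/
theorem lemma1 :
    ∃ K : ℕ, ∀ (n : ℕ) (C : Finset (RubiksCube.Pos n)), RubiksCube.IsCluster C →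
      (∀ (c : RubiksCube.Config n) (v : List (RubiksCube.Move n)),
        RubiksCube.AgreeOn C c (RubiksCube.applyMoves v (RubiksCube.solved n)) →
        RubiksCube.EvenOn C v →
        ∃ w : List (RubiksCube.Move n), w.length ≤ K ∧
          RubiksCube.AgreeOn C (RubiksCube.applyMoves w c) (RubiksCube.solved n) ∧
          (∀ f : RubiksCube.Facelet n, f.pos ∈ C →
            RubiksCube.run w (RubiksCube.run v f) = f) ∧
          RubiksCube.AffectsOnly C w) ∧
      ((∀ p ∈ C, ¬ RubiksCube.IsFaceMidpoint p) →
        ∀ π : Equiv.Perm C, Equiv.Perm.sign π = 1 →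
        ∃ w : List (RubiksCube.Move n), w.length ≤ K ∧
          RubiksCube.Realizes w π ∧ RubiksCube.AffectsOnly C w) := by
  -- At most `1296!` factors, each a word of at most 8 moves between a conjugator of at most `1296!`
  -- moves and its inverse.
  refine ⟨Nat.factorial 1296 * (2 * Nat.factorial 1296 + 8), fun n C hC =>
    ⟨fun c v hc hv => ?_, fun hmid π hπ => ?_⟩⟩
  rotate_left
  · obtain ⟨u, ⟨-, t, ht, htu⟩, rfl⟩ := exists_restrictPos_eq_of_sign hC hmid hπ
    obtain ⟨w, hw, haff, rfl⟩ := hC.exists_short_of_mem_clusterGroup ht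
    refine ⟨w, hw, fun p => ?_, haff⟩
    obtain ⟨f, hf⟩ := hC.exists_facelet p.2
    have := congrArg Facelet.pos (htu f (hf ▸ p.2))
    rwa [run_pos, run_pos, hf] at this
  · obtain ⟨-, t, ht, htv⟩ := run_mem_localGroup_of_evenOn hC hv
    -- A short sequence for the inverse of the local element `t` that imitates `v` on `C` brings
    -- each sticker home; the colours follow.
    obtain ⟨w, hw, haff, hwt⟩ := hC.exists_short_of_mem_clusterGroup (inv_mem ht)
    refine ⟨w, hw, fun f hf => ?_, fun f hf => ?_, haff⟩
    · change c ((run w)⁻¹ f) = f.face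
      rw [hwt, inv_inv, htv f hf, hc _ ((hC.run_mem_iff v f).2 hf)]
      change ((run v)⁻¹ (run v f)).face = f.face
      rw [← Equiv.Perm.mul_apply, inv_mul_cancel, Equiv.Perm.one_apply]
    · rw [hwt, ← htv f hf, ← Equiv.Perm.mul_apply, inv_mul_cancel, Equiv.Perm.one_apply]
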